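/- Let $M$ be a real-analytic manifold of dimension $2n+1$ with a real-analytic CR structure of hypersurface type, that is, a complex rank $n$ real-analytic distribution $H\subset \mathbb{C}TM$ with $[H,H]\subset H$ and $H\cap\overline H=0$. Let $K_p\subset H_p$ be the kernel of the Levi form $(X,Y)\mapsto \frac i2[X,\overline Y]_p \bmod H_p\oplus\overline H_p$, and assume that $\dim K_p=r$ for all $p\in M$. For $v\in\overline K_p$ let $\mathrm{ad}_v:H_p/K_p\to\overline H_p/\overline K_p$ be the linear map $y\mapsto [V,Y]_p \bmod H_p\oplus\overline K_p$, where $V\in\Gamma(\overline K)$ and $Y\in\Gamma(H)$ satisfy $V(p)=v$ and $Y(p)\equiv y \bmod K_p$. Assume that $H$ is 2-nondegenerate, that is, $K_p\ne0$ and $\mathrm{ad}_v\neq 0$ for every nonzero $v\in\overline K_p$ and every $p\in M$. The dynamical Legendrian contact structure of $H$ near a point of $M$ is defined as follows. Take a small complexification $U$ of a neighbourhood of the point, with its conjugation $\tau$ and the holomorphic extensions of $H$ and $K$, and let $\pi:U\to\mathcal N$ be the projection onto the leaf space of the foliation tangent to $K\oplus\tau_*K$. On $\mathcal N$ one has the distribution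 $\mathcal D=\pi_*(H\oplus\tau_*H)$, the involution induced by $\tau$, and, for each $\gamma\in\mathcal N$, the families of subspaces $J^-_\gamma=\{\pi_*H_q:\pi(q)=\gamma\}$ and $J^+_\gamma=\{\pi_*(\tau_*H)_q:\pi(q)=\gamma\}$ of $\mathcal D_\gamma$. Here $U$ is a connected, $\tau$-invariant open set, so small that the extensions keep on $U$ the pointwise properties of $H$ and $K$, that the fibres of $\pi$ are connected, and that $q\mapsto(\pi_*H_q,\pi_*(\tau_*H)_q)$ is an embedding that identifies $U$ with the bundle over $\mathcal N$ with fibres $J^-_\gamma\times J^+_\gamma$. The CR structure $H$ is called recoverable if near every point it is uniquely determined by its dynamical Legendrian contact structure: whenever a CR structure $H'$ of the same kind (with the same $n$ and $r$), with complexification $U'$ and projection $\pi':U'\to\mathcal N$ onto the leaf space, induces the same dynamical Legendrian contact structure $(\mathcal N,\mathcal D,J^-,J^+)$ with the same involution, there is a biholomorphism $\Phi:U\to U'$ with $\pi'\circ\Phi=\pi$ that commutes with the conjugations and satisfies $\Phi_*H=H'$ (so that $\Phi$ restricts to a CR equivalence of the real parts). Theorem. Suppose that for a generic point $p\in M$ (that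 is, for all $p$ in a dense subset of $M$) there is no nonzero subspace $L$ of $\overline K_p$ satisfying $$\dim\Bigl(\bigcap_{v\in L}\ker \mathrm{ad}_v\Bigr)\ \ge\ \mathrm{rank}\,H-\mathrm{rank}\,K-\dim L .$$ Then the CR structure $H$ is recoverable. -/

import Mathlib

open scoped ContDiff Manifold Topology TensorProduct

noncomputable section

namespace CRGeom

/-- Real coordinate space. -/
abbrev RSp (m : ℕ) := Fin m → ℝ

/-- Complex coordinate space: the complexification of `RSp m`, and the fibre of the complexified
tangent bundle of `RSp m`. The conjugation of `RSp m ⊂ CSp m` is `star`. -/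
abbrev CSp (m : ℕ) := Fin m → ℂ

/-- The inclusion of the real points, as a real-linear map. -/
def incl (m : ℕ) : RSp m →ₗ[ℝ] CSp m :=
  LinearMap.compLeft Complex.ofRealCLM.toLinearMap (Fin m)

/-- The complex conjugate of a complex subspace. -/
def conjSub {m : ℕ} (L : Submodule ℂ (CSp m)) : Submodule ℂ (CSp m) where
  carrier := {v | star v ∈ L}
  add_mem' := by
    intro a b ha hb
    simpa using L.add_mem ha hb
  zero_mem' := by simp
  smul_mem' := by
    intro c v hv
    simpa using L.smul_mem (star c) hv

/-- `D` is a `𝕜`-analytic distribution of complex rank `n` on `S`: locally it is spanned by `n`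
pointwise linearly independent analytic fields. Used for `𝕜 = ℝ` (real-analytic complex
distributions on open sets of `RSp m`) and `𝕜 = ℂ` (holomorphic distributions on open sets of
`CSp m`). -/
def IsAnalyticDistribution (𝕜 : Type*) [NontriviallyNormedField 𝕜] {E : Type*}
    [NormedAddCommGroup E] [NormedSpace 𝕜 E] {m : ℕ} [NormedSpace 𝕜 (CSp m)]
    (S : Set E) (n : ℕ) (D : E → Submodule ℂ (CSp m)) : Prop :=
  ∀ x ∈ S, ∃ b : Fin n → E → CSp m, (∀ i, AnalyticAt 𝕜 (b i) x) ∧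
    ∀ᶠ y in 𝓝 x, LinearIndependent ℂ (fun i => b i y) ∧
      D y = Submodule.span ℂ (Set.range fun i => b i y)

/-! ### CR structures on open sets of real coordinate space -/

section Real

variable {m : ℕ}

/-- `X` is (the germ at `x` of) a smooth section of the complex distribution `D`. -/
def IsSec (D : RSp m → Submodule ℂ (CSp m)) (x : RSp m) (X : RSp m → CSp m) : Prop :=
  ContDiffAt ℝ ∞ X x ∧ ∀ᶠ y in 𝓝 x, X y ∈ D y

/-- Derivative at `x` of a function along a complex tangent vector `w = a + i b`. -/
def cderiv (X : RSp m → CSp m) (x : RSp m) (w : CSp m) : CSp m :=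
  fderiv ℝ X x (fun i => (w i).re) + Complex.I • fderiv ℝ X x (fun i => (w i).im)

/-- Lie bracket of complex vector fields (the complex bilinear extension of the bracket of real
vector fields). -/
def cbracket (X Y : RSp m → CSp m) (x : RSp m) : CSp m :=
  cderiv Y x (X x) - cderiv X x (Y x)

/-- The complex conjugate distribution. -/
def conjDist (D : RSp m → Submodule ℂ (CSp m)) : RSp m → Submodule ℂ (CSp m) :=
  fun x => conjSub (D x)

theorem IsSec.add {D : RSp m → Submodule ℂ (CSp m)} {x : RSp m} {X Y : RSp m → CSp m}
    (hX : IsSec D x X) (hY : IsSec D x Y) : IsSec D x (X + Y) :=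
  ⟨hX.1.add hY.1, by
    filter_upwards [hX.2, hY.2] with y h1 h2 using (D y).add_mem h1 h2⟩

theorem IsSec.smul {D : RSp m → Submodule ℂ (CSp m)} {x : RSp m} {X : RSp m → CSp m} (c : ℂ)
    (hX : IsSec D x X) : IsSec D x (c • X) :=
  ⟨hX.1.const_smul c, by
    filter_upwards [hX.2] with y h1 using (D y).smul_mem c h1⟩

theorem IsSec.zero (D : RSp m → Submodule ℂ (CSp m)) (x : RSp m) : IsSec D x 0 :=
  ⟨contDiffAt_const, Filter.Eventually.of_forall fun y => (D y).zero_mem⟩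

theorem IsSec.differentiableAt {D : RSp m → Submodule ℂ (CSp m)} {x : RSp m}
    {X : RSp m → CSp m} (hX : IsSec D x X) : DifferentiableAt ℝ X x :=
  hX.1.differentiableAt (by simp)

theorem cderiv_vec_add (X : RSp m → CSp m) (x : RSp m) (v w : CSp m) :
    cderiv X x (v + w) = cderiv X x v + cderiv X x w := by
  have h1 : (fun i => ((v + w) i).re) = (fun i => (v i).re) + fun i => (w i).re := by
    ext i; simp
  have h2 : (fun i => ((v + w) i).im) = (fun i => (v i).im) + fun i => (w i).im := by
    ext i; simp
  simp only [cderiv, h1, h2, map_add, smul_add]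
  abel

theorem cderiv_vec_smul (X : RSp m → CSp m) (x : RSp m) (c : ℂ) (v : CSp m) :
    cderiv X x (c • v) = c • cderiv X x v := by
  have h1 : (fun i => ((c • v) i).re) = c.re • (fun i => (v i).re) - c.im • fun i => (v i).im := by
    ext i; simp
  have h2 : (fun i => ((c • v) i).im) = c.re • (fun i => (v i).im) + c.im • fun i => (v i).re := by
    ext i; simp
  simp only [cderiv, h1, h2, map_add, map_sub, map_smul]
  ext i
  simp only [Pi.add_apply, Pi.sub_apply, Pi.smul_apply, smul_eq_mul, Complex.real_smul]
  apply Complex.ext <;> simp <;> ring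

theorem cderiv_add {X Y : RSp m → CSp m} {x : RSp m} (hX : DifferentiableAt ℝ X x)
    (hY : DifferentiableAt ℝ Y x) (w : CSp m) :
    cderiv (X + Y) x w = cderiv X x w + cderiv Y x w := by
  simp only [cderiv, fderiv_add hX hY, add_apply, smul_add]
  abel

theorem cderiv_smul {X : RSp m → CSp m} {x : RSp m} (hX : DifferentiableAt ℝ X x) (c : ℂ)
    (w : CSp m) : cderiv (c • X) x w = c • cderiv X x w := by
  simp only [cderiv, fderiv_const_smul hX c, smul_apply, smul_add]
  rw [smul_comm]

theorem cbracket_add_left {X Y Z : RSp m → CSp m} {x : RSp m} (hX : DifferentiableAt ℝ X x)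
    (hY : DifferentiableAt ℝ Y x) :
    cbracket (X + Y) Z x = cbracket X Z x + cbracket Y Z x := by
  simp only [cbracket, Pi.add_apply, cderiv_vec_add, cderiv_add hX hY]
  abel

theorem cbracket_smul_left {X Z : RSp m → CSp m} {x : RSp m} (hX : DifferentiableAt ℝ X x)
    (c : ℂ) : cbracket (c • X) Z x = c • cbracket X Z x := by
  simp only [cbracket, Pi.smul_apply, cderiv_vec_smul, cderiv_smul hX, smul_sub]

theorem cbracket_zero_left (Z : RSp m → CSp m) (x : RSp m) :
    cbracket 0 Z x = 0 := by
  have h := cbracket_smul_left (X := 0) (Z := Z) (x := x) (differentiableAt_const 0) 0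
  simpa using h

theorem cbracket_swap (X Y : RSp m → CSp m) (x : RSp m) :
    cbracket X Y x = -cbracket Y X x := by
  simp [cbracket]

/-- The kernel `K_x` of the Levi form `(X, Y) ↦ (i/2) [X, conj Y] mod H ⊕ conj H` of `H`. The class
of the bracket depends only on the values of the sections at `x`. -/
def leviKernel (H : RSp m → Submodule ℂ (CSp m)) (x : RSp m) : Submodule ℂ (CSp m) where
  carrier := {v | ∃ X, IsSec H x X ∧ X x = v ∧
    ∀ Y, IsSec (conjDist H) x Y → cbracket X Y x ∈ H x ⊔ conjDist H x}
  add_mem' := by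
    rintro _ _ ⟨X, hX, rfl, h⟩ ⟨X', hX', rfl, h'⟩
    refine ⟨X + X', hX.add hX', rfl, fun Y hY => ?_⟩
    rw [cbracket_add_left hX.differentiableAt hX'.differentiableAt]
    exact Submodule.add_mem _ (h Y hY) (h' Y hY)
  zero_mem' := ⟨0, IsSec.zero H x, rfl, fun Y _ => by
    rw [cbracket_zero_left]; exact Submodule.zero_mem _⟩
  smul_mem' := by
    rintro c _ ⟨X, hX, rfl, h⟩
    refine ⟨c • X, hX.smul c, rfl, fun Y hY => ?_⟩
    rw [cbracket_smul_left hX.differentiableAt]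
    exact Submodule.smul_mem _ c (h Y hY)

/-- For `v ∈ conj K_x`, the preimage in `H_x` of the kernel of
`ad_v : H_x / K_x → conj H_x / conj K_x`, `y ↦ [V, Y]_x mod H_x ⊕ conj K_x`, where `V` and `Y` are
sections of `conj K` and `H` through `v` and `y`. (The class of the bracket depends only on
`v` and `y`.) -/
def adKernel (H : RSp m → Submodule ℂ (CSp m)) (x : RSp m) (v : CSp m) :
    Submodule ℂ (CSp m) where
  carrier := {y | ∃ Y, IsSec H x Y ∧ Y x = y ∧
    ∀ V, IsSec (conjDist (leviKernel H)) x V → V x = v →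
      cbracket V Y x ∈ H x ⊔ conjDist (leviKernel H) x}
  add_mem' := by
    rintro _ _ ⟨X, hX, rfl, h⟩ ⟨X', hX', rfl, h'⟩
    refine ⟨X + X', hX.add hX', rfl, fun V hV hv => ?_⟩
    rw [cbracket_swap, cbracket_add_left hX.differentiableAt hX'.differentiableAt, neg_add,
      ← cbracket_swap, ← cbracket_swap]
    exact Submodule.add_mem _ (h V hV hv) (h' V hV hv)
  zero_mem' := ⟨0, IsSec.zero H x, rfl, fun V _ _ => by
    rw [cbracket_swap, cbracket_zero_left, neg_zero]; exact Submodule.zero_mem _⟩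
  smul_mem' := by
    rintro c _ ⟨X, hX, rfl, h⟩
    refine ⟨c • X, hX.smul c, rfl, fun V hV hv => ?_⟩
    rw [cbracket_swap, cbracket_smul_left hX.differentiableAt, ← smul_neg, ← cbracket_swap]
    exact Submodule.smul_mem _ c (h V hV hv)

/-- The intersection of the kernels of `ad_v`, `v ∈ L`, as a subspace of `H_x / K_x`. -/
def adKernelInter (H : RSp m → Submodule ℂ (CSp m)) (x : RSp m) (L : Submodule ℂ (CSp m)) :
    Submodule ℂ (H x ⧸ (leviKernel H x).submoduleOf (H x)) :=
  ⨅ v ∈ L, ((adKernel H x v).submoduleOf (H x)).map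
    ((leviKernel H x).submoduleOf (H x)).mkQ

/-- There is no nonzero subspace `L` of `conj K_x` with
`dim (⋂_{v ∈ L} ker ad_v) ≥ rank H - rank K - dim L`. -/
def NoLargeKernel (n r : ℕ) (H : RSp m → Submodule ℂ (CSp m)) (x : RSp m) : Prop :=
  ¬ ∃ L : Submodule ℂ (CSp m), L ≠ ⊥ ∧ L ≤ conjDist (leviKernel H) x ∧
    (Module.finrank ℂ (adKernelInter H x L) : ℤ) ≥ (n : ℤ) - r - Module.finrank ℂ L

end Real

/-- `H` is a real-analytic, 2-nondegenerate CR structure of hypersurface type on the open set `W`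
of `(2n+1)`-dimensional space, of rank `n` and with Levi kernel of constant rank `r`. -/
structure IsCRStructure (n r : ℕ) (W : Set (RSp (2 * n + 1)))
    (H : RSp (2 * n + 1) → Submodule ℂ (CSp (2 * n + 1))) : Prop where
  isOpen : IsOpen W
  dist : IsAnalyticDistribution ℝ W n H
  involutive : ∀ x ∈ W, ∀ X Y, IsSec H x X → IsSec H x Y → cbracket X Y x ∈ H x
  totallyReal : ∀ x ∈ W, Disjoint (H x) (conjDist H x)
  rank_kernel : ∀ x ∈ W, Module.finrank ℂ (leviKernel H x) = r
  kernel_ne_bot : ∀ x ∈ W, leviKernel H x ≠ ⊥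
  nondegenerate : ∀ x ∈ W, ∀ V, IsSec (leviKernel H) x V → V x ≠ 0 →
    ∃ Y, IsSec (conjDist H) x Y ∧ cbracket V Y x ∉ leviKernel H x ⊔ conjDist H x

/-! ### The complexification -/

section Complex

variable {m : ℕ}

/-- `X` is (the germ at `z` of) a holomorphic section of `D`. -/
def IsHolSec (D : CSp m → Submodule ℂ (CSp m)) (z : CSp m) (X : CSp m → CSp m) : Prop :=
  AnalyticAt ℂ X z ∧ ∀ᶠ w in 𝓝 z, X w ∈ D w

/-- The distribution `τ_* D`, where `τ = star` is the conjugation of `CSp m`. -/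
def conjHol (D : CSp m → Submodule ℂ (CSp m)) : CSp m → Submodule ℂ (CSp m) :=
  fun z => conjSub (D (star z))

open VectorField in
/-- The Levi kernel of a holomorphic distribution `D` (with respect to `τ_* D`). -/
def holKernel (D : CSp m → Submodule ℂ (CSp m)) (z : CSp m) : Submodule ℂ (CSp m) where
  carrier := {v | ∃ X, IsHolSec D z X ∧ X z = v ∧
    ∀ Y, IsHolSec (conjHol D) z Y → lieBracket ℂ X Y z ∈ D z ⊔ conjHol D z}
  add_mem' := by
    rintro _ _ ⟨X, hX, rfl, h⟩ ⟨X', hX', rfl, h'⟩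
    refine ⟨X + X', ⟨hX.1.add hX'.1, ?_⟩, rfl, fun Y hY => ?_⟩
    · filter_upwards [hX.2, hX'.2] with y h1 h2 using (D y).add_mem h1 h2
    · rw [lieBracket_add_left hX.1.differentiableAt hX'.1.differentiableAt]
      exact Submodule.add_mem _ (h Y hY) (h' Y hY)
  zero_mem' := ⟨0, ⟨analyticAt_const, Filter.Eventually.of_forall fun y => (D y).zero_mem⟩, rfl,
    fun Y _ => by
      simp only [lieBracket_zero_left, Pi.zero_apply]
      exact Submodule.zero_mem _⟩
  smul_mem' := by
    rintro c _ ⟨X, hX, rfl, h⟩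
    refine ⟨c • X, ⟨analyticAt_const.smul hX.1, ?_⟩, rfl, fun Y hY => ?_⟩
    · filter_upwards [hX.2] with y h1 using (D y).smul_mem c h1
    · rw [lieBracket_const_smul_left hX.1.differentiableAt]
      exact Submodule.smul_mem _ c (h Y hY)

end Complex

/-- `U` with the holomorphic distribution `Hc` is a (small) complexification of the CR structure `H`
on `W`: `U` is a connected open set invariant under the conjugation `τ = star`, its real points lie
in `W`, `Hc` extends `H` holomorphically, and `U` is so small that the defining properties of `H`
(integrability, total reality, constant rank of the Levi kernel, 2-nondegeneracy) hold for `Hc` on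
all of `U`. -/
structure IsComplexification (n r : ℕ) (W : Set (RSp (2 * n + 1)))
    (H : RSp (2 * n + 1) → Submodule ℂ (CSp (2 * n + 1))) (U : Set (CSp (2 * n + 1)))
    (Hc : CSp (2 * n + 1) → Submodule ℂ (CSp (2 * n + 1))) : Prop where
  isOpen : IsOpen U
  isConnected : IsConnected U
  star_mem : ∀ z ∈ U, star z ∈ U
  real_mem : ∀ x, incl _ x ∈ U → x ∈ W
  extends_real : ∀ x, incl _ x ∈ U → Hc (incl _ x) = H x
  dist : IsAnalyticDistribution ℂ U n Hc
  dist_kernel : IsAnalyticDistribution ℂ U r (holKernel Hc)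
  involutive : ∀ z ∈ U, ∀ X Y, IsHolSec Hc z X → IsHolSec Hc z Y →
    VectorField.lieBracket ℂ X Y z ∈ Hc z
  disjoint : ∀ z ∈ U, Disjoint (Hc z) (conjHol Hc z)
  nondegenerate : ∀ z ∈ U, ∀ V, IsHolSec (holKernel Hc) z V → V z ≠ 0 →
    ∃ Y, IsHolSec (conjHol Hc) z Y ∧
      VectorField.lieBracket ℂ V Y z ∉ holKernel Hc z ⊔ conjHol Hc z

/-! ### The Levi leaf space and its dynamical Legendrian contact structure -/

/-- Complex subspaces of `CSp k`, with the topology in which a subspace is close to `Λ` when it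
passes close to each vector of a finite list of vectors of `Λ`. On the subspaces of any fixed
dimension this is the usual topology of the Grassmannian. -/
def Subspaces (k : ℕ) := Submodule ℂ (CSp k)

instance (k : ℕ) : TopologicalSpace (Subspaces k) :=
  TopologicalSpace.generateFrom
    {S | ∃ O : Set (CSp k), IsOpen O ∧ S = {Λ | ∃ v ∈ O, v ∈ (show Submodule ℂ (CSp k) from Λ)}}

section Leaf

variable {m k : ℕ}

/-- The image under `π_*` of a distribution at `z`. -/
def pushAt (π : CSp m → CSp k) (D : CSp m → Submodule ℂ (CSp m)) (z : CSp m) : Subspaces k :=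
  (D z).map (fderiv ℂ π z).toLinearMap

/-- The map `z ↦ (π z, J⁻(z), J⁺(z))`, with `J⁻(z) = π_* H_z` and `J⁺(z) = π_* (τ_* H)_z`. -/
def canF (π : CSp m → CSp k) (Hc : CSp m → Submodule ℂ (CSp m)) (z : CSp m) :
    CSp k × Subspaces k × Subspaces k :=
  (π z, pushAt π Hc z, pushAt π (conjHol Hc) z)

/-- `π : U → π(U)` realizes the Levi leaf space: it is a holomorphic submersion onto an open set of
`CSp k` whose fibres are the leaves of the foliation by the integral manifolds of `K ⊕ τ_* K`, and
`U` has been shrunk so that the families `J⁻_γ = {J⁻(z) : π z = γ}`, `J⁺_γ = {J⁺(z) : π z = γ}` are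
embedded and `canF` identifies `U` with the bundle of the products `J⁻_γ × J⁺_γ`. -/
structure IsLeviLeafSpace (U : Set (CSp m)) (Hc : CSp m → Submodule ℂ (CSp m))
    (π : CSp m → CSp k) : Prop where
  holomorphic : DifferentiableOn ℂ π U
  submersion : ∀ z ∈ U, LinearMap.range (fderiv ℂ π z).toLinearMap = ⊤
  ker_eq : ∀ z ∈ U, LinearMap.ker (fderiv ℂ π z).toLinearMap =
    holKernel Hc z ⊔ conjHol (holKernel Hc) z
  leaf_connected : ∀ γ, IsPreconnected (U ∩ π ⁻¹' {γ})
  embedding : Topology.IsEmbedding (fun z : U => canF π Hc z)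
  product : ∀ z₁ ∈ U, ∀ z₂ ∈ U, π z₁ = π z₂ → ∃ z ∈ U, π z = π z₁ ∧
    pushAt π Hc z = pushAt π Hc z₁ ∧ pushAt π (conjHol Hc) z = pushAt π (conjHol Hc) z₂

end Leaf

/-- The data of a dynamical Legendrian contact structure with involution on a domain of `CSp k`:
the domain, the distribution on it, the families of subspaces `J⁻_γ`, `J⁺_γ` in each fibre of the
distribution, and (the graph of) the involution of the domain. -/
structure DynamicalLegendrian (k : ℕ) where
  domain : Set (CSp k)
  contact : CSp k → Submodule ℂ (CSp k)
  Jminus : CSp k → Set (Subspaces k)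
  Jplus : CSp k → Set (Subspaces k)
  involution : Set (CSp k × CSp k)

/-- The dynamical Legendrian contact structure on the Levi leaf space. The distribution
`π_* (H ⊕ τ_* H)` is constant along the fibres of `π`, so the supremum below is over equal
subspaces. -/
def associated {m k : ℕ} (U : Set (CSp m)) (Hc : CSp m → Submodule ℂ (CSp m))
    (π : CSp m → CSp k) : DynamicalLegendrian k where
  domain := π '' U
  contact := fun γ => ⨆ z ∈ U ∩ π ⁻¹' {γ},
    (Hc z ⊔ conjHol Hc z).map (fderiv ℂ π z).toLinearMap
  Jminus := fun γ => {Λ | ∃ z ∈ U, π z = γ ∧ Λ = pushAt π Hc z}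
  Jplus := fun γ => {Λ | ∃ z ∈ U, π z = γ ∧ Λ = pushAt π (conjHol Hc) z}
  involution := {q | ∃ z ∈ U, q = (π z, π (star z))}

/-- `Φ` is an isomorphism from the complexified CR structure `(U, Hc)` over its leaf space to
`(U', Hc')`: a biholomorphism that covers the identity of the leaf space, commutes with the
conjugations (so it restricts to a real-analytic diffeomorphism of the real points) and maps `Hc` to
`Hc'` (so this restriction is a CR equivalence). -/
def IsCRIso {m k : ℕ} (U U' : Set (CSp m)) (Hc Hc' : CSp m → Submodule ℂ (CSp m))
    (π π' : CSp m → CSp k) (Φ : CSp m → CSp m) : Prop :=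
  Set.BijOn Φ U U' ∧ DifferentiableOn ℂ Φ U ∧ DifferentiableOn ℂ (Function.invFunOn Φ U) U' ∧
    (∀ z ∈ U, π' (Φ z) = π z) ∧ (∀ z ∈ U, Φ (star z) = star (Φ z)) ∧
    ∀ z ∈ U, (Hc z).map (fderiv ℂ Φ z).toLinearMap = Hc' (Φ z)

/-- The germ at `p` of the CR structure `H` on `W` is uniquely determined by its dynamical Legendrian
contact structure: every CR structure `H'` with the same dynamical Legendrian contact structure is
isomorphic to it over the leaf space. (The leaf space of `H'` is used through a realization `π'` on
the same domain; an isomorphism of leaf spaces may be absorbed into `π'`.) -/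
def RecoverableAt (n r : ℕ) (W : Set (RSp (2 * n + 1)))
    (H : RSp (2 * n + 1) → Submodule ℂ (CSp (2 * n + 1))) (p : RSp (2 * n + 1)) : Prop :=
  ∀ (k : ℕ) (U : Set (CSp (2 * n + 1))) (Hc : CSp (2 * n + 1) → Submodule ℂ (CSp (2 * n + 1)))
    (π : CSp (2 * n + 1) → CSp k),
    incl _ p ∈ U → IsComplexification n r W H U Hc → IsLeviLeafSpace U Hc π →
  ∀ (W' : Set (RSp (2 * n + 1))) (H' : RSp (2 * n + 1) → Submodule ℂ (CSp (2 * n + 1)))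
    (U' : Set (CSp (2 * n + 1))) (Hc' : CSp (2 * n + 1) → Submodule ℂ (CSp (2 * n + 1)))
    (π' : CSp (2 * n + 1) → CSp k),
    IsCRStructure n r W' H' → IsComplexification n r W' H' U' Hc' → IsLeviLeafSpace U' Hc' π' →
    associated U' Hc' π' = associated U Hc π →
    ∃ Φ, IsCRIso U U' Hc Hc' π π' Φ

/-! ### CR structures on real-analytic manifolds -/

section Manifold

variable {m : ℕ} {M : Type*} [TopologicalSpace M] [ChartedSpace (RSp m) M]

/-- The expression in the chart `e` of a family `H` of subspaces of the complexified tangent spaces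
of `M`: at `x = e p` it is the image of `H_p` under the complexified differential of `e`. -/
def chartDist (H : ∀ p : M, Submodule ℂ (ℂ ⊗[ℝ] TangentSpace 𝓘(ℝ, RSp m) p))
    (e : OpenPartialHomeomorph M (RSp m)) (x : RSp m) : Submodule ℂ (CSp m) :=
  (H (e.symm x)).map (LinearMap.liftBaseChange ℂ
    (incl m ∘ₗ (mfderiv 𝓘(ℝ, RSp m) 𝓘(ℝ, RSp m) e (e.symm x)).toLinearMap))

end Manifold

section Manifold

variable {n : ℕ} {M : Type*} [TopologicalSpace M] [ChartedSpace (RSp (2 * n + 1)) M]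

/-- `H` is a real-analytic, 2-nondegenerate CR structure of hypersurface type on the manifold `M`
of dimension `2n+1`, with Levi kernel of constant rank `r` (a local property, read in charts). -/
def IsCRManifold (r : ℕ)
    (H : ∀ p : M, Submodule ℂ (ℂ ⊗[ℝ] TangentSpace 𝓘(ℝ, RSp (2 * n + 1)) p)) : Prop :=
  ∀ e ∈ IsManifold.maximalAtlas 𝓘(ℝ, RSp (2 * n + 1)) ω M,
    IsCRStructure n r e.target (chartDist H e)

/-- At the point `p` no nonzero subspace `L` of `conj K_p` has
`dim (⋂_{v ∈ L} ker ad_v) ≥ rank H - rank K - dim L` (read in charts). -/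
def NoLargeKernelAt (r : ℕ)
    (H : ∀ p : M, Submodule ℂ (ℂ ⊗[ℝ] TangentSpace 𝓘(ℝ, RSp (2 * n + 1)) p)) (p : M) : Prop :=
  ∀ e ∈ IsManifold.maximalAtlas 𝓘(ℝ, RSp (2 * n + 1)) ω M, p ∈ e.source →
    NoLargeKernel n r (chartDist H e) (e p)

/-- The CR structure `H` is recoverable: near every point, in every chart, it is uniquely determined
by its dynamical Legendrian contact structure. -/
def IsRecoverable (r : ℕ)
    (H : ∀ p : M, Submodule ℂ (ℂ ⊗[ℝ] TangentSpace 𝓘(ℝ, RSp (2 * n + 1)) p)) : Prop :=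
  ∀ p : M, ∀ e ∈ IsManifold.maximalAtlas 𝓘(ℝ, RSp (2 * n + 1)) ω M, p ∈ e.source →
    RecoverableAt n r e.target (chartDist H e) (e p)

end Manifold

end CRGeom

end

noncomputable section

namespace CRGeom

/-! ### Holomorphic maps of several variables are analytic -/

section Osgood

open MeasureTheory Metric Set

variable {F : Type*} [NormedAddCommGroup F] [NormedSpace ℂ F] [CompleteSpace F]

/-! Write K for the Levi kernel and a bar for conjugates, and let H and H' induce the same structure
on the leaf space. The map `canF`, z ↦ (π z, J⁻(z), J⁺(z)), embeds both complexifications with the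
same image, hence gives a homeomorphism Φ : U → U' over the leaf space. By 2-nondegeneracy the
derivative of J⁻ along a leaf has kernel inside K, that of J⁺ has kernel inside K̄. Since K ∩ K̄ =
0, `canF` is an immersion in Grassmannian charts, and Φ is biholomorphic
(`LeviPair.mem_kernel_of_fderiv_eq_zero`, `LeviPair.analyticAt_of_canonical`,
`IsComplexification.exists_biholOn`).

Pull H' back to U by Φ and keep the name. As ker dπ = K ⊕ K̄, the equality π_*H' = π_*H means H' ⊕
K̄' = H ⊕ K̄, and 2-nondegeneracy then forces K ⊂ H' (`LeviPair.kernel_le_of_sup_eq`). The deviation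
of H' from H is measured by L = K̄ ∩ (H + H'). Put N = H ∩ H', which contains K. Then dim N + dim L
= n (`LeviPair.finrank_inf_add`), and involutivity of H and H' makes ad_v vanish on N for every v in
L (`LeviPair.lieBracket_mem_of_mem_inf`). So the common kernel of the ad_v, v ∈ L, has dimension at
least n - r - dim L. At generic real points the hypothesis leaves only L = 0, that is, H' ⊂ H. This
inclusion is locally the vanishing of analytic functions, so it spreads from a dense set of real
points to the connected set U (`LeviPair.le_of_real_dense`), and equality follows by rank.

That Φ commutes with the conjugations is a separate argument (`IsComplexification.canonical_star`).
The pull-back of H' is not known beforehand to be compatible with the conjugation, so the comparison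
is made for quadruples `LeviPair` in which no conjugation relates the two halves. -/

theorem torusMap_mem_closedBall {m : ℕ} (c : Fin m → ℂ) {R : ℝ} (hR : 0 ≤ R) (θ : Fin m → ℝ) :
    torusMap c (fun _ => R) θ ∈ closedBall c R := by
  rw [mem_closedBall, dist_pi_le_iff hR]
  intro i
  simp [torusMap, dist_eq_norm, abs_of_nonneg hR]

theorem torusMap_sub_ne_zero {m : ℕ} {c w : Fin m → ℂ} {R : ℝ} (hw : w ∈ ball c R)
    (θ : Fin m → ℝ) (i : Fin m) : torusMap c (fun _ => R) θ i - w i ≠ 0 := by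
  have hR : 0 < R := pos_of_mem_ball hw
  intro h
  have h1 : dist (w i) (c i) < R := (dist_le_pi_dist w c i).trans_lt hw
  rw [← sub_eq_zero.1 h] at h1
  simp [torusMap, dist_eq_norm, abs_of_pos hR] at h1

theorem continuous_torusMap {m : ℕ} (c : Fin m → ℂ) (R : Fin m → ℝ) :
    Continuous (torusMap c R) := by
  unfold torusMap; fun_prop

/-- Cauchy's integral formula on a polydisc. -/
theorem torusIntegral_prod_sub_inv_smul {m : ℕ} {f : (Fin m → ℂ) → F} {U : Set (Fin m → ℂ)}
    (hf : DifferentiableOn ℂ f U) {c w : Fin m → ℂ} {R : ℝ}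
    (hU : closedBall c R ⊆ U) (hw : w ∈ ball c R) :
    torusIntegral (fun ζ => (∏ i, (ζ i - w i)⁻¹) • f ζ) c (fun _ => R) =
      (2 * Real.pi * Complex.I : ℂ) ^ m • f w := by
  have hR : 0 < R := pos_of_mem_ball hw
  induction m with
  | zero => simp [Subsingleton.elim c w]
  | succ m ih =>
    have hint : TorusIntegrable (fun ζ => (∏ i, (ζ i - w i)⁻¹) • f ζ) c (fun _ => R) := by
      refine Continuous.integrableOn_Icc ?_
      refine Continuous.smul (continuous_finsetProd _ fun i _ => Continuous.inv₀ ?_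
        fun θ => torusMap_sub_ne_zero hw θ i) ?_
      · have := continuous_torusMap c (fun _ => R)
        fun_prop
      · exact hf.continuousOn.comp_continuous (continuous_torusMap _ _)
          fun θ => hU (torusMap_mem_closedBall c hR.le θ)
    have hw0 : w 0 ∈ ball (c 0) R := (dist_le_pi_dist w c 0).trans_lt hw
    have hwt : Fin.tail w ∈ ball (Fin.tail c) R := by
      rw [mem_ball, dist_pi_lt_iff hR]
      exact fun i => (dist_le_pi_dist w c i.succ).trans_lt hw
    have hcons : ∀ x ∈ closedBall (c 0) R, ∀ y ∈ closedBall (Fin.tail c) R,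
        (Fin.cons x y : Fin (m + 1) → ℂ) ∈ U := by
      intro x hx y hy
      apply hU
      rw [mem_closedBall, dist_pi_le_iff hR.le]
      intro i
      refine Fin.cases ?_ (fun j => ?_) i
      · simpa using hx
      · exact (dist_le_pi_dist y (Fin.tail c) j).trans hy
    -- With the first variable frozen on its circle, the induction hypothesis evaluates the integral
    -- over the remaining m variables; the one-variable Cauchy formula then handles the first.
    have key : ∀ x ∈ sphere (c 0) R,
        torusIntegral (fun y => (∏ i, ((Fin.cons x y : Fin (m + 1) → ℂ) i - w i)⁻¹) •
          f (Fin.cons x y)) (c ∘ Fin.succ) ((fun _ => R) ∘ Fin.succ) =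
        (x - w 0)⁻¹ • (2 * Real.pi * Complex.I : ℂ) ^ m • f (Fin.cons x (Fin.tail w)) := by
      intro x hx
      have hx' := sphere_subset_closedBall hx
      have h1 := ih (f := fun y => f (Fin.cons x y)) (U := closedBall (Fin.tail c) R)
        (c := Fin.tail c) (w := Fin.tail w) (by
          intro y hy
          refine (hf _ (hcons x hx' y hy)).comp y ?_ fun y' hy' => hcons x hx' y' hy'
          refine DifferentiableAt.differentiableWithinAt ?_
          rw [differentiableAt_pi]
          intro i
          refine Fin.cases ?_ (fun j => ?_) i
          · simp
          · simpa using differentiableAt_apply j y) subset_rfl hwt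
      rw [← h1, ← torusIntegral_smul]
      congr 1
      funext y
      rw [Fin.prod_univ_succ, smul_smul]
      rfl
    rw [torusIntegral_succ hint, circleIntegral.integral_congr hR.le key]
    have h2 : DifferentiableOn ℂ (fun x => (2 * Real.pi * Complex.I : ℂ) ^ m •
        f (Fin.cons x (Fin.tail w))) (closedBall (c 0) R) := by
      intro x hx
      refine DifferentiableWithinAt.const_smul ?_ _
      refine (hf _ (hcons x hx _ (ball_subset_closedBall hwt))).comp x ?_
        fun x' hx' => hcons x' hx' _ (ball_subset_closedBall hwt)
      refine DifferentiableAt.differentiableWithinAt ?_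
      rw [differentiableAt_pi]
      intro i
      refine Fin.cases ?_ (fun j => ?_) i
      · simp
      · simp
    have h3 := h2.circleIntegral_sub_inv_smul hw0
    rw [h3, smul_smul, Fin.cons_self_tail, pow_succ']

/-- Osgood's lemma. -/
theorem analyticAt_of_differentiableOn {m : ℕ} {f : (Fin m → ℂ) → F} {U : Set (Fin m → ℂ)}
    (hUo : IsOpen U) (hf : DifferentiableOn ℂ f U) {c : Fin m → ℂ} (hc : c ∈ U) :
    AnalyticAt ℂ f c := by
  obtain ⟨R, hR, hRU⟩ := nhds_basis_closedBall.mem_iff.1 (hUo.mem_nhds hc)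
  -- Cauchy's formula is read as f(w) = const • L(κ(w)), with L a continuous linear map on the
  -- Banach algebra C(T, ℂ) and κ(w) the Cauchy kernel. Inversion in a Banach algebra is analytic,
  -- so κ is analytic, and hence f.
  let T : Set (Fin m → ℝ) := Icc 0 fun _ => 2 * Real.pi
  let e : Fin m → C(T, ℂ) := fun i =>
    ⟨fun θ => torusMap c (fun _ => R) θ i,
      (continuous_pi_iff.1 (continuous_torusMap c fun _ => R) i).comp continuous_subtype_val⟩
  -- The part of the integrand that does not depend on w: the Jacobian factors of `torusMap` times
  -- f.
  let h : C(T, F) :=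
    ⟨fun θ => (∏ i : Fin m, (R : ℂ) * Complex.exp ((θ : Fin m → ℝ) i * Complex.I) * Complex.I) •
      f (torusMap c (fun _ => R) θ), by
      refine Continuous.smul (continuous_finsetProd _ fun i _ => ?_) ?_
      · have : Continuous fun θ : Fin m → ℝ => (R : ℂ) * Complex.exp (θ i * Complex.I) *
            Complex.I := by fun_prop
        exact this.comp continuous_subtype_val
      exact hf.continuousOn.comp_continuous
        ((continuous_torusMap _ _).comp continuous_subtype_val)
        fun θ => hRU (torusMap_mem_closedBall c hR.le θ)⟩
  have : IsFiniteMeasure (Measure.comap (Subtype.val : T → Fin m → ℝ) volume) := by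
    constructor
    rw [comap_subtype_coe_apply measurableSet_Icc]
    exact (measure_mono (Subtype.coe_image_subset T univ)).trans_lt measure_Icc_lt_top
  have hi : ∀ g : C(T, F), Integrable g (Measure.comap (Subtype.val : T → Fin m → ℝ) volume) :=
    fun g => g.continuous.integrable_of_hasCompactSupport (HasCompactSupport.of_compactSpace _)
  let L0 : C(T, ℂ) →ₗ[ℂ] F :=
    { toFun := fun g => ∫ θ, (g • h) θ ∂(Measure.comap (Subtype.val : T → Fin m → ℝ) volume)
      map_add' := fun a b => by
        rw [← integral_add (hi _) (hi _)]
        simp [add_smul]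
      map_smul' := fun a b => by
        rw [RingHom.id_apply, ← integral_smul]
        simp [smul_smul] }
  let L : C(T, ℂ) →L[ℂ] F := L0.mkContinuous
    (‖h‖ * (Measure.comap (Subtype.val : T → Fin m → ℝ) volume).real univ) (by
      intro g
      calc ‖L0 g‖ ≤ (‖g‖ * ‖h‖) *
            (Measure.comap (Subtype.val : T → Fin m → ℝ) volume).real univ := by
            refine norm_integral_le_of_norm_le_const (Filter.Eventually.of_forall fun θ => ?_)
            have : (g • h) θ = g θ • h θ := rfl
            rw [this, norm_smul]
            gcongr
            · exact g.norm_coe_le_norm θ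
            · exact h.norm_coe_le_norm θ
        _ = _ := by ring)
  let κ : (Fin m → ℂ) → C(T, ℂ) := fun w =>
    ∏ i, Ring.inverse (e i - algebraMap ℂ C(T, ℂ) (w i))
  have hunit : ∀ w ∈ ball c R, ∀ i, IsUnit (e i - algebraMap ℂ C(T, ℂ) (w i)) := by
    intro w hw i
    rw [ContinuousMap.isUnit_iff_forall_ne_zero]
    exact fun θ => torusMap_sub_ne_zero hw θ i
  have hκ : AnalyticAt ℂ κ c := by
    refine Finset.analyticAt_fun_prod _ fun i _ => ?_
    obtain ⟨u, hu⟩ := hunit c (mem_ball_self hR) i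
    have h1 : AnalyticAt ℂ (Ring.inverse : C(T, ℂ) → C(T, ℂ))
        (e i - algebraMap ℂ C(T, ℂ) (c i)) := hu ▸ analyticAt_inverse (𝕜 := ℂ) u
    have h2 : AnalyticAt ℂ (fun w : Fin m → ℂ => e i - algebraMap ℂ C(T, ℂ) (w i)) c := by
      refine analyticAt_const.sub ?_
      exact ((algebraMapCLM ℂ C(T, ℂ)).comp
          (ContinuousLinearMap.proj (R := ℂ) (φ := fun _ : Fin m => ℂ) i)).analyticAt c
    exact AnalyticAt.fun_comp (g := Ring.inverse) h1 h2
  have hev : f =ᶠ[𝓝 c] fun w => ((2 * Real.pi * Complex.I : ℂ) ^ m)⁻¹ • L (κ w) := by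
    filter_upwards [ball_mem_nhds c hR] with w hw
    have h0 : ((2 * Real.pi * Complex.I : ℂ) ^ m) ≠ 0 :=
      pow_ne_zero _ Complex.two_pi_I_ne_zero
    rw [eq_inv_smul_iff₀ h0, ← torusIntegral_prod_sub_inv_smul hf hRU hw, torusIntegral]
    have hinv : ∀ i (θ : T), (Ring.inverse (e i - algebraMap ℂ C(T, ℂ) (w i))) θ =
        (torusMap c (fun _ => R) θ i - w i)⁻¹ := by
      intro i θ
      have h1 := congrArg (fun g : C(T, ℂ) => g θ) (Ring.inverse_mul_cancel _ (hunit w hw i))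
      exact eq_inv_of_mul_eq_one_left h1
    rw [← integral_subtype_comap measurableSet_Icc]
    change _ = ∫ θ, (κ w • h) θ ∂_
    congr 1
    funext θ
    have h2 : (κ w • h) θ = κ w θ • h θ := rfl
    rw [h2]
    simp only [κ, ContinuousMap.coe_prod, Finset.prod_apply, hinv]
    exact smul_comm _ _ _
  exact ((L.analyticAt _).comp hκ).const_smul.congr hev.symm

end Osgood

/-! ### Analytic families of linear maps and splittings of distributions -/

section Splitting

variable {E : Type*} [NormedAddCommGroup E] [NormedSpace ℂ E]

theorem _root_.AnalyticAt.clm_apply' {V W : Type*} [NormedAddCommGroup V] [NormedSpace ℂ V]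
    [NormedAddCommGroup W] [NormedSpace ℂ W] {f : E → V →L[ℂ] W} {g : E → V} {z : E}
    (hf : AnalyticAt ℂ f z) (hg : AnalyticAt ℂ g z) : AnalyticAt ℂ (fun y => f y (g y)) z :=
  AnalyticAt.comp₂ (h := fun p : V × (V →L[ℂ] W) => ContinuousLinearMap.apply ℂ W p.1 p.2)
    (ContinuousLinearMap.analyticAt_bilinear (ContinuousLinearMap.apply ℂ W) (g z, f z)) hg hf

theorem _root_.AnalyticAt.clm_comp' {V W X : Type*} [NormedAddCommGroup V] [NormedSpace ℂ V]
    [NormedAddCommGroup W] [NormedSpace ℂ W] [NormedAddCommGroup X] [NormedSpace ℂ X]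
    {f : E → W →L[ℂ] X} {g : E → V →L[ℂ] W} {z : E}
    (hf : AnalyticAt ℂ f z) (hg : AnalyticAt ℂ g z) :
    AnalyticAt ℂ (fun y => (f y).comp (g y)) z :=
  AnalyticAt.comp₂
    (h := fun p : (W →L[ℂ] X) × (V →L[ℂ] W) => ContinuousLinearMap.compL ℂ V W X p.1 p.2)
    (ContinuousLinearMap.analyticAt_bilinear (ContinuousLinearMap.compL ℂ V W X) (f z, g z)) hf hg

/-- The units of the Banach algebra of operators form an open set on which inversion is analytic.
The normalization at z costs nothing in the applications: there T is first composed with a fixed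
left inverse of its value at z. -/
theorem exists_analytic_inverse {V : Type*} [NormedAddCommGroup V] [NormedSpace ℂ V]
    [CompleteSpace V] {T : E → V →L[ℂ] V} {z : E} (hT : AnalyticAt ℂ T z)
    (h1 : T z = ContinuousLinearMap.id ℂ V) :
    ∃ S : E → V →L[ℂ] V, AnalyticAt ℂ S z ∧
      ∀ᶠ y in 𝓝 z, (∀ v, S y (T y v) = v) ∧ ∀ v, T y (S y v) = v := by
  have h1' : T z = ((1 : (V →L[ℂ] V)ˣ) : V →L[ℂ] V) := h1
  refine ⟨fun y => Ring.inverse (T y), ?_, ?_⟩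
  · exact AnalyticAt.fun_comp (g := Ring.inverse)
      (h1' ▸ analyticAt_inverse (𝕜 := ℂ) (1 : (V →L[ℂ] V)ˣ)) hT
  · have h2 : ∀ᶠ y in 𝓝 z, IsUnit (T y) :=
      hT.continuousAt.eventually (h1' ▸ Units.nhds (1 : (V →L[ℂ] V)ˣ))
    filter_upwards [h2] with y hy
    exact ⟨fun v => congrArg (fun A : V →L[ℂ] V => A v) (Ring.inverse_mul_cancel _ hy),
      fun v => congrArg (fun A : V →L[ℂ] V => A v) (Ring.mul_inverse_cancel _ hy)⟩

variable {m : ℕ}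

/-- Coordinates with respect to a moving frame. A fixed left inverse q of the frame map B at z makes
q ∘ B the identity at z; inverting q ∘ B nearby corrects q to a left inverse of B y. -/
theorem exists_analytic_coeff {ι : Type*} [Fintype ι] {b : ι → E → CSp m} {z : E}
    (hb : ∀ i, AnalyticAt ℂ (b i) z) (hli : LinearIndependent ℂ fun i => b i z) :
    ∃ φ : E → CSp m →L[ℂ] (ι → ℂ), AnalyticAt ℂ φ z ∧
      ∀ᶠ y in 𝓝 z, ∀ a : ι → ℂ, φ y (∑ i, a i • b i y) = a := by
  let B : E → (ι → ℂ) →L[ℂ] CSp m := fun y =>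
    ∑ i, ContinuousLinearMap.smulRightL ℂ (ι → ℂ) (CSp m)
      (ContinuousLinearMap.proj (R := ℂ) (φ := fun _ : ι => ℂ) i) (b i y)
  have hB : AnalyticAt ℂ B z := Finset.analyticAt_fun_sum _ fun i _ =>
    AnalyticAt.fun_comp (ContinuousLinearMap.analyticAt _ _) (hb i)
  have hBa : ∀ y a, B y a = ∑ i, a i • b i y := by
    intro y a; simp [B]
  have hinj : Function.Injective (B z).toLinearMap := by
    rw [← LinearMap.ker_eq_bot, LinearMap.ker_eq_bot']
    intro a ha
    have := Fintype.linearIndependent_iff.1 hli a (by rw [← hBa]; exact ha)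
    exact funext this
  obtain ⟨q, hq⟩ := (B z).toLinearMap.exists_leftInverse_of_injective
    (LinearMap.ker_eq_bot.2 hinj)
  let q' : CSp m →L[ℂ] (ι → ℂ) := LinearMap.toContinuousLinearMap q
  have hT : AnalyticAt ℂ (fun y => q'.comp (B y)) z := AnalyticAt.clm_comp' analyticAt_const hB
  obtain ⟨S, hS, hS'⟩ := exists_analytic_inverse hT (by
    ext1 a; exact congrArg (fun f => f a) hq)
  refine ⟨fun y => (S y).comp q', AnalyticAt.clm_comp' hS analyticAt_const, ?_⟩
  filter_upwards [hS'] with y hy a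
  rw [← hBa]
  exact hy.1 a

/-- Analytic projections onto two independent distributions. -/
theorem exists_splitting {S₁ S₂ : Set E} {n₁ n₂ : ℕ} {D₁ D₂ : E → Submodule ℂ (CSp m)}
    (h₁ : IsAnalyticDistribution ℂ S₁ n₁ D₁) (h₂ : IsAnalyticDistribution ℂ S₂ n₂ D₂)
    {z : E} (hz₁ : z ∈ S₁) (hz₂ : z ∈ S₂) (hd : Disjoint (D₁ z) (D₂ z)) :
    ∃ P₁ P₂ : E → CSp m →L[ℂ] CSp m, AnalyticAt ℂ P₁ z ∧ AnalyticAt ℂ P₂ z ∧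
      ∀ᶠ y in 𝓝 z, (∀ v, P₁ y v ∈ D₁ y) ∧ (∀ v, P₂ y v ∈ D₂ y) ∧
        (∀ v ∈ D₁ y, P₁ y v = v ∧ P₂ y v = 0) ∧ (∀ v ∈ D₂ y, P₁ y v = 0 ∧ P₂ y v = v) := by
  obtain ⟨b, hb, hbe⟩ := h₁ z hz₁
  obtain ⟨c, hc, hce⟩ := h₂ z hz₂
  let s : Fin n₁ ⊕ Fin n₂ → E → CSp m := Sum.elim b c
  have hs : ∀ i, AnalyticAt ℂ (s i) z := by
    rintro (i | i)
    · exact hb i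
    · exact hc i
  have hli : LinearIndependent ℂ fun i => s i z := by
    have h := hbe.self_of_nhds.1.sum_type hce.self_of_nhds.1
      (by rw [← hbe.self_of_nhds.2, ← hce.self_of_nhds.2]; exact hd)
    have e : (fun i => s i z) = Sum.elim (fun i => b i z) fun i => c i z := by
      funext i
      rcases i with i | i <;> rfl
    rw [e]
    exact h
  obtain ⟨φ, hφ, hφe⟩ := exists_analytic_coeff hs hli
  let pr : ∀ i : Fin n₁ ⊕ Fin n₂, (Fin n₁ ⊕ Fin n₂ → ℂ) →L[ℂ] ℂ := fun i =>
    ContinuousLinearMap.proj (R := ℂ) (φ := fun _ : Fin n₁ ⊕ Fin n₂ => ℂ) i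
  have han : ∀ i, AnalyticAt ℂ (fun y => ContinuousLinearMap.smulRightL ℂ (CSp m) (CSp m)
      ((pr i).comp (φ y)) (s i y)) z := by
    intro i
    have h1 : AnalyticAt ℂ (fun y => (pr i).comp (φ y)) z := AnalyticAt.clm_comp' analyticAt_const hφ
    have h2 : AnalyticAt ℂ (fun y => ContinuousLinearMap.smulRightL ℂ (CSp m) (CSp m)
      ((pr i).comp (φ y))) z := AnalyticAt.fun_comp (ContinuousLinearMap.analyticAt _ _) h1
    exact AnalyticAt.clm_apply' h2 (hs i)
  refine ⟨fun y => ∑ i : Fin n₁, ContinuousLinearMap.smulRightL ℂ (CSp m) (CSp m)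
      ((pr (Sum.inl i)).comp (φ y)) (s (Sum.inl i) y),
    fun y => ∑ i : Fin n₂, ContinuousLinearMap.smulRightL ℂ (CSp m) (CSp m)
      ((pr (Sum.inr i)).comp (φ y)) (s (Sum.inr i) y),
    Finset.analyticAt_fun_sum _ fun i _ => han _, Finset.analyticAt_fun_sum _ fun i _ => han _, ?_⟩
  filter_upwards [hbe, hce, hφe] with y hby hcy hφy
  have e1 : ∀ v, (∑ i : Fin n₁, ContinuousLinearMap.smulRightL ℂ (CSp m) (CSp m)
      ((pr (Sum.inl i)).comp (φ y)) (s (Sum.inl i) y)) v =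
      ∑ i : Fin n₁, φ y v (Sum.inl i) • b i y := by
    intro v; simp [pr, s]
  have e2 : ∀ v, (∑ i : Fin n₂, ContinuousLinearMap.smulRightL ℂ (CSp m) (CSp m)
      ((pr (Sum.inr i)).comp (φ y)) (s (Sum.inr i) y)) v =
      ∑ i : Fin n₂, φ y v (Sum.inr i) • c i y := by
    intro v; simp [pr, s]
  refine ⟨fun v => ?_, fun v => ?_, fun v hv => ?_, fun v hv => ?_⟩
  · rw [e1, hby.2]
    exact Submodule.sum_mem _ fun i _ => Submodule.smul_mem _ _
      (Submodule.subset_span (Set.mem_range_self i))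
  · rw [e2, hcy.2]
    exact Submodule.sum_mem _ fun i _ => Submodule.smul_mem _ _
      (Submodule.subset_span (Set.mem_range_self i))
  · rw [hby.2, Submodule.mem_span_range_iff_exists_fun] at hv
    obtain ⟨a, rfl⟩ := hv
    have h := hφy (Sum.elim a 0)
    simp only [Fintype.sum_sum_type, Sum.elim_inl, Sum.elim_inr, Pi.zero_apply, zero_smul,
      Finset.sum_const_zero, add_zero, s] at h
    rw [e1, e2, h]
    simp
  · rw [hcy.2, Submodule.mem_span_range_iff_exists_fun] at hv
    obtain ⟨a, rfl⟩ := hv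
    have h := hφy (Sum.elim 0 a)
    simp only [Fintype.sum_sum_type, Sum.elim_inl, Sum.elim_inr, Pi.zero_apply, zero_smul,
      Finset.sum_const_zero, zero_add, s] at h
    rw [e1, e2, h]
    simp

/-- Serves as the trivial second summand that turns a splitting into a single projection. -/
theorem isAnalyticDistribution_bot (S : Set E) :
    IsAnalyticDistribution ℂ S 0 fun _ : E => (⊥ : Submodule ℂ (CSp m)) := by
  intro x _
  refine ⟨fun _ => 0, fun i => i.elim0, Filter.Eventually.of_forall fun y => ?_⟩
  exact ⟨linearIndependent_empty_type, by simp⟩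

/-- An analytic projection onto a distribution. -/
theorem IsAnalyticDistribution.exists_proj {S : Set E} {n : ℕ} {D : E → Submodule ℂ (CSp m)}
    (h : IsAnalyticDistribution ℂ S n D) {z : E} (hz : z ∈ S) :
    ∃ P : E → CSp m →L[ℂ] CSp m, AnalyticAt ℂ P z ∧
      ∀ᶠ y in 𝓝 z, (∀ v, P y v ∈ D y) ∧ ∀ v ∈ D y, P y v = v := by
  obtain ⟨P, _, hP, -, hPe⟩ := exists_splitting h (isAnalyticDistribution_bot S) hz hz
    disjoint_bot_right
  exact ⟨P, hP, hPe.mono fun y hy => ⟨hy.1, fun v hv => (hy.2.2.1 v hv).1⟩⟩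

theorem IsAnalyticDistribution.finrank_eq {S : Set E} {n : ℕ} {D : E → Submodule ℂ (CSp m)}
    (h : IsAnalyticDistribution ℂ S n D) {z : E} (hz : z ∈ S) :
    Module.finrank ℂ (D z) = n := by
  obtain ⟨b, -, hb⟩ := h z hz
  rw [hb.self_of_nhds.2, finrank_span_eq_card hb.self_of_nhds.1, Fintype.card_fin]

end Splitting

/-! ### Holomorphic sections -/

section Sections

variable {m : ℕ} {S : Set (CSp m)} {n : ℕ} {D : CSp m → Submodule ℂ (CSp m)} {z : CSp m}

theorem IsHolSec.mem {X : CSp m → CSp m} (hX : IsHolSec D z X) : X z ∈ D z :=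
  hX.2.self_of_nhds

theorem IsHolSec.mono {D' : CSp m → Submodule ℂ (CSp m)} {X : CSp m → CSp m}
    (hX : IsHolSec D z X) (h : ∀ᶠ y in 𝓝 z, D y ≤ D' y) : IsHolSec D' z X :=
  ⟨hX.1, by filter_upwards [hX.2, h] with y h1 h2 using h2 h1⟩

theorem IsHolSec.sub {X Y : CSp m → CSp m} (hX : IsHolSec D z X) (hY : IsHolSec D z Y) :
    IsHolSec D z (X - Y) :=
  ⟨hX.1.sub hY.1, by filter_upwards [hX.2, hY.2] with y h1 h2 using (D y).sub_mem h1 h2⟩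

theorem IsAnalyticDistribution.exists_isHolSec (h : IsAnalyticDistribution ℂ S n D) (hz : z ∈ S)
    {v : CSp m} (hv : v ∈ D z) : ∃ X, IsHolSec D z X ∧ X z = v := by
  obtain ⟨P, hP, hPe⟩ := h.exists_proj hz
  exact ⟨fun y => P y v, ⟨AnalyticAt.clm_apply' hP analyticAt_const, hPe.mono fun y hy => hy.1 v⟩,
    hPe.self_of_nhds.2 v hv⟩

/-- The derivative of a section that vanishes at a point lies in the distribution. -/
theorem IsAnalyticDistribution.fderiv_mem (h : IsAnalyticDistribution ℂ S n D) (hz : z ∈ S)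
    {X : CSp m → CSp m} (hX : IsHolSec D z X) (h0 : X z = 0) (w : CSp m) :
    fderiv ℂ X z w ∈ D z := by
  obtain ⟨P, hP, hPe⟩ := h.exists_proj hz
  -- Differentiating X = P X at a zero of X kills the term with dP and leaves dX = P(z) dX, whose
  -- values lie in D z.
  have he : X =ᶠ[𝓝 z] fun y => P y (X y) := by
    filter_upwards [hPe, hX.2] with y h1 h2 using (h1.2 _ h2).symm
  have hd := (AnalyticAt.differentiableAt hP).hasFDerivAt.clm_apply hX.1.differentiableAt.hasFDerivAt
  rw [he.fderiv_eq, hd.fderiv]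
  simp only [h0, ContinuousLinearMap.comp_apply, map_zero, add_zero]
  exact hPe.self_of_nhds.1 _

open VectorField in
-- Only the term -dX(Y) of the bracket survives where X vanishes. Hence modulo D a bracket with a
-- section of D depends on that section only through its value at the point.
theorem lieBracket_mem_of_eq_zero (h : IsAnalyticDistribution ℂ S n D) (hz : z ∈ S)
    {X : CSp m → CSp m} (hX : IsHolSec D z X) (h0 : X z = 0) (Y : CSp m → CSp m) :
    lieBracket ℂ X Y z ∈ D z := by
  rw [lieBracket_eq]
  simp only [h0, map_zero, zero_sub]
  exact (D z).neg_mem (h.fderiv_mem hz hX h0 _)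

open VectorField in
theorem lieBracket_mem_of_eq_zero_right (h : IsAnalyticDistribution ℂ S n D) (hz : z ∈ S)
    {X : CSp m → CSp m} (hX : IsHolSec D z X) (h0 : X z = 0) (Y : CSp m → CSp m) :
    lieBracket ℂ Y X z ∈ D z := by
  rw [lieBracket_swap]
  exact (D z).neg_mem (lieBracket_mem_of_eq_zero h hz hX h0 Y)

/-- Sections of a direct sum split. -/
theorem exists_split_isHolSec {S' : Set (CSp m)} {n' : ℕ} {D' E : CSp m → Submodule ℂ (CSp m)}
    (h : IsAnalyticDistribution ℂ S n D) (h' : IsAnalyticDistribution ℂ S' n' D')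
    (hz : z ∈ S) (hz' : z ∈ S') (hd : Disjoint (D z) (D' z)) {X : CSp m → CSp m}
    (hX : IsHolSec E z X) (hE : ∀ᶠ y in 𝓝 z, E y ≤ D y ⊔ D' y) :
    ∃ A B, IsHolSec D z A ∧ IsHolSec D' z B ∧ X =ᶠ[𝓝 z] A + B := by
  obtain ⟨P, Q, hP, hQ, hPQ⟩ := exists_splitting h h' hz hz' hd
  refine ⟨fun y => P y (X y), fun y => Q y (X y), ⟨AnalyticAt.clm_apply' hP hX.1, hPQ.mono fun y hy => hy.1 _⟩,
    ⟨AnalyticAt.clm_apply' hQ hX.1, hPQ.mono fun y hy => hy.2.1 _⟩, ?_⟩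
  filter_upwards [hPQ, hX.2, hE] with y hy hXy hEy
  obtain ⟨a, ha, b, hb, hab⟩ := Submodule.mem_sup.1 (hEy hXy)
  have h1 := hy.2.2.1 a ha
  have h2 := hy.2.2.2 b hb
  simp only [Pi.add_apply, ← hab, map_add, h1, h2, zero_add, add_zero]

end Sections

/-! ### Conjugation of holomorphic maps -/

section Conj

variable {m k : ℕ}

/-- The conjugate `star ∘ X ∘ star` of a map. -/
def conjMap (X : CSp m → CSp k) : CSp m → CSp k := fun z => star (X (star z))

@[simp] theorem conjMap_conjMap (X : CSp m → CSp k) : conjMap (conjMap X) = X := by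
  funext z; simp [conjMap]

theorem tendsto_star (z : CSp m) : Filter.Tendsto star (𝓝 z) (𝓝 (star z)) :=
  continuous_star.tendsto z

theorem hasFDerivAt_conjMap {X : CSp m → CSp k} {z : CSp m}
    (hX : DifferentiableAt ℂ X (star z)) :
    HasFDerivAt (conjMap X) ((starL ℂ).toContinuousLinearMap.comp <|
      (fderiv ℂ X (star z)).comp (starL ℂ).toContinuousLinearMap : CSp m →L[ℂ] CSp k) z := by
  have h := hX.hasFDerivAt.star_star
  rw [star_star] at h
  exact h

theorem fderiv_conjMap {X : CSp m → CSp k} {z : CSp m} (hX : DifferentiableAt ℂ X (star z))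
    (w : CSp m) : fderiv ℂ (conjMap X) z w = star (fderiv ℂ X (star z) (star w)) := by
  rw [(hasFDerivAt_conjMap hX).fderiv]; rfl

/-- Conjugating both source and target keeps the derivative complex linear, so `conjMap X` is
complex differentiable near z, and Osgood's lemma makes it analytic. -/
theorem analyticAt_conjMap {X : CSp m → CSp k} {z : CSp m} (hX : AnalyticAt ℂ X (star z)) :
    AnalyticAt ℂ (conjMap X) z := by
  obtain ⟨V, hV, hVo, hzV⟩ := eventually_nhds_iff.1
    ((tendsto_star z).eventually hX.eventually_analyticAt)
  exact analyticAt_of_differentiableOn hVo (fun y hy =>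
    (hasFDerivAt_conjMap (hV y hy).differentiableAt).differentiableAt.differentiableWithinAt) hzV

theorem lieBracket_conjMap {X Y : CSp m → CSp m} {z : CSp m} (hX : AnalyticAt ℂ X (star z))
    (hY : AnalyticAt ℂ Y (star z)) :
    VectorField.lieBracket ℂ (conjMap X) (conjMap Y) z =
      star (VectorField.lieBracket ℂ X Y (star z)) := by
  simp only [VectorField.lieBracket_eq, fderiv_conjMap hX.differentiableAt,
    fderiv_conjMap hY.differentiableAt, conjMap, star_star, star_sub]

theorem mem_conjSub {L : Submodule ℂ (CSp m)} {v : CSp m} : v ∈ conjSub L ↔ star v ∈ L :=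
  Iff.rfl

@[simp] theorem conjSub_conjSub (L : Submodule ℂ (CSp m)) : conjSub (conjSub L) = L := by
  ext v; simp [mem_conjSub]

theorem conjSub_mono {L L' : Submodule ℂ (CSp m)} (h : L ≤ L') : conjSub L ≤ conjSub L' :=
  fun _ hv => h hv

theorem conjSub_sup (L L' : Submodule ℂ (CSp m)) :
    conjSub (L ⊔ L') = conjSub L ⊔ conjSub L' := by
  apply le_antisymm
  · rw [← conjSub_conjSub (conjSub L ⊔ conjSub L')]
    refine conjSub_mono (sup_le ?_ ?_)
    · rw [← conjSub_conjSub L]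
      exact conjSub_mono (by simp)
    · rw [← conjSub_conjSub L']
      exact conjSub_mono (by simp)
  · exact sup_le (conjSub_mono le_sup_left) (conjSub_mono le_sup_right)

theorem mem_conjHol {D : CSp m → Submodule ℂ (CSp m)} {z v : CSp m} :
    v ∈ conjHol D z ↔ star v ∈ D (star z) := Iff.rfl

@[simp] theorem conjHol_conjHol (D : CSp m → Submodule ℂ (CSp m)) : conjHol (conjHol D) = D := by
  funext z; simp [conjHol]

theorem IsHolSec.conj {D : CSp m → Submodule ℂ (CSp m)} {z : CSp m} {X : CSp m → CSp m}
    (hX : IsHolSec D (star z) X) : IsHolSec (conjHol D) z (conjMap X) :=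
  ⟨analyticAt_conjMap hX.1, by
    filter_upwards [(tendsto_star z).eventually hX.2] with y hy
    simpa [mem_conjHol, conjMap] using hy⟩

theorem IsHolSec.conj' {D : CSp m → Submodule ℂ (CSp m)} {z : CSp m} {X : CSp m → CSp m}
    (hX : IsHolSec (conjHol D) z X) : IsHolSec D (star z) (conjMap X) := by
  rw [← conjHol_conjHol D]
  exact IsHolSec.conj (by simpa using hX)

theorem LinearIndependent.star_comp {n : ℕ} {b : Fin n → CSp m} (h : LinearIndependent ℂ b) :
    LinearIndependent ℂ fun i => star (b i) := by
  rw [Fintype.linearIndependent_iff] at h ⊢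
  intro g hg i
  have := h (fun i => star (g i)) (by
    have h2 := congrArg star hg
    simpa only [star_sum, star_smul, star_star, star_zero] using h2) i
  simpa using this

theorem conjSub_span_range {n : ℕ} (b : Fin n → CSp m) :
    conjSub (Submodule.span ℂ (Set.range b)) =
      Submodule.span ℂ (Set.range fun i => star (b i)) := by
  ext v
  rw [mem_conjSub, Submodule.mem_span_range_iff_exists_fun,
    Submodule.mem_span_range_iff_exists_fun]
  constructor
  · rintro ⟨c, hc⟩
    refine ⟨fun i => star (c i), ?_⟩
    have := congrArg star hc
    simpa only [star_sum, star_smul, star_star] using this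
  · rintro ⟨c, rfl⟩
    exact ⟨fun i => star (c i), by simp only [star_sum, star_smul, star_star]⟩

theorem IsAnalyticDistribution.conjHol {U : Set (CSp m)} {n : ℕ}
    {D : CSp m → Submodule ℂ (CSp m)} (h : IsAnalyticDistribution ℂ U n D)
    (hU : ∀ z ∈ U, star z ∈ U) : IsAnalyticDistribution ℂ U n (conjHol D) := by
  intro z hz
  obtain ⟨b, hb, hbe⟩ := h _ (hU z hz)
  refine ⟨fun i => conjMap (b i), fun i => analyticAt_conjMap (hb i), ?_⟩
  filter_upwards [(tendsto_star z).eventually hbe] with y hy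
  refine ⟨LinearIndependent.star_comp hy.1, ?_⟩
  rw [CRGeom.conjHol, hy.2, conjSub_span_range]
  rfl

end Conj

/-! ### Pairs of transverse distributions with their Levi kernels -/

open VectorField

/-- A pair of transverse involutive holomorphic distributions `H`, `Hb` on `U` with subdistributions
`K`, `Kb` subject to the nondegeneracy condition satisfied by the Levi kernels of a complexified
2-nondegenerate CR structure. -/
structure LeviPair {m : ℕ} (n r : ℕ) (U : Set (CSp m)) (H Hb K Kb : CSp m → Submodule ℂ (CSp m)) :
    Prop where
  isOpen : IsOpen U
  dist : IsAnalyticDistribution ℂ U n H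
  dist_bar : IsAnalyticDistribution ℂ U n Hb
  dist_kernel : IsAnalyticDistribution ℂ U r K
  dist_kernel_bar : IsAnalyticDistribution ℂ U r Kb
  kernel_le : ∀ z ∈ U, K z ≤ H z
  kernel_bar_le : ∀ z ∈ U, Kb z ≤ Hb z
  disjoint : ∀ z ∈ U, Disjoint (H z) (Hb z)
  involutive : ∀ z ∈ U, ∀ X Y, IsHolSec H z X → IsHolSec H z Y → lieBracket ℂ X Y z ∈ H z
  involutive_bar : ∀ z ∈ U, ∀ X Y, IsHolSec Hb z X → IsHolSec Hb z Y → lieBracket ℂ X Y z ∈ Hb z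
  nondegenerate : ∀ z ∈ U, ∀ V, IsHolSec K z V →
    (∀ Y, IsHolSec Hb z Y → lieBracket ℂ V Y z ∈ K z ⊔ Hb z) → V z = 0
  nondegenerate_bar : ∀ z ∈ U, ∀ V, IsHolSec Kb z V →
    (∀ Y, IsHolSec H z Y → lieBracket ℂ V Y z ∈ Kb z ⊔ H z) → V z = 0

theorem LeviPair.swap {m n r : ℕ} {U : Set (CSp m)} {H Hb K Kb : CSp m → Submodule ℂ (CSp m)}
    (h : LeviPair n r U H Hb K Kb) : LeviPair n r U Hb H Kb K :=
  ⟨h.isOpen, h.dist_bar, h.dist, h.dist_kernel_bar, h.dist_kernel, h.kernel_bar_le, h.kernel_le,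
    fun z hz => (h.disjoint z hz).symm, h.involutive_bar, h.involutive, h.nondegenerate_bar,
    h.nondegenerate⟩

theorem holKernel_le {m : ℕ} (D : CSp m → Submodule ℂ (CSp m)) (z : CSp m) :
    holKernel D z ≤ D z := by
  rintro _ ⟨X, hX, rfl, -⟩
  exact hX.mem

/-- The conditions on the barred distributions at z are the conjugates of those on `Hc` at `star z`.
-/
theorem IsComplexification.leviPair {n r : ℕ} {W : Set (RSp (2 * n + 1))}
    {H : RSp (2 * n + 1) → Submodule ℂ (CSp (2 * n + 1))} {U : Set (CSp (2 * n + 1))}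
    {Hc : CSp (2 * n + 1) → Submodule ℂ (CSp (2 * n + 1))} (h : IsComplexification n r W H U Hc) :
    LeviPair n r U Hc (conjHol Hc) (holKernel Hc) (conjHol (holKernel Hc)) where
  isOpen := h.isOpen
  dist := h.dist
  dist_bar := h.dist.conjHol h.star_mem
  dist_kernel := h.dist_kernel
  dist_kernel_bar := h.dist_kernel.conjHol h.star_mem
  kernel_le z _ := holKernel_le _ z
  kernel_bar_le z _ := conjSub_mono (holKernel_le _ _)
  disjoint := h.disjoint
  involutive := h.involutive
  involutive_bar z hz X Y hX hY := by
    have h1 := h.involutive _ (h.star_mem z hz) _ _ hX.conj' hY.conj'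
    rw [lieBracket_conjMap (by simpa using hX.1) (by simpa using hY.1), star_star] at h1
    exact h1
  nondegenerate z hz V hV hY := by
    by_contra h0
    obtain ⟨Y, hYs, hYb⟩ := h.nondegenerate z hz V hV h0
    exact hYb (hY Y hYs)
  nondegenerate_bar z hz V hV hY := by
    by_contra h0
    obtain ⟨Y, hYs, hYb⟩ := h.nondegenerate _ (h.star_mem z hz) _ hV.conj' (by
      simpa [conjMap] using h0)
    refine hYb ?_
    have h1 := hY _ (by simpa using hYs.conj')
    have h2 := lieBracket_conjMap (X := conjMap V) (Y := Y) (z := z)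
      (hV.conj').1 hYs.1
    rw [conjMap_conjMap] at h2
    rw [h2] at h1
    have h3 : conjHol (holKernel Hc) z ⊔ Hc z =
        conjSub (holKernel Hc (star z) ⊔ conjHol Hc (star z)) := by
      rw [conjSub_sup]; simp [conjHol]
    rw [h3, mem_conjSub, star_star] at h1
    exact h1

/-! ### Local inverses -/

section LocalInverse

variable {E F : Type*} [NormedAddCommGroup E] [NormedSpace ℂ E] [CompleteSpace E]
  [NormedAddCommGroup F] [NormedSpace ℂ F]

theorem exists_analytic_local_inverse [CompleteSpace F] {f : E → F} {z : E} (hf : AnalyticAt ℂ f z)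
    (f' : E ≃L[ℂ] F) (hf' : fderiv ℂ f z = f') :
    ∃ Ψ : F → E, AnalyticAt ℂ Ψ (f z) ∧ (∀ᶠ y in 𝓝 z, Ψ (f y) = y) ∧
      ∀ᶠ p in 𝓝 (f z), f (Ψ p) = p := by
  have hc : ContDiffAt ℂ ω f z := hf.contDiffAt
  have hd : HasFDerivAt f (f' : E →L[ℂ] F) z := hf' ▸ hf.differentiableAt.hasFDerivAt
  have hs := hc.hasStrictFDerivAt' hd (by simp)
  refine ⟨hc.localInverse hd (by simp), ?_, hs.eventually_left_inverse,
    hs.eventually_right_inverse⟩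
  exact ((hc.to_localInverse hd (by simp)).analyticAt)

/-- An immersion followed by a linear left inverse of its derivative at z has derivative the
identity there, so the inverse function theorem applies to the composite. -/
theorem exists_analytic_local_left_inverse [FiniteDimensional ℂ F] {f : E → F} {z : E}
    (hf : AnalyticAt ℂ f z) (hinj : ∀ w, fderiv ℂ f z w = 0 → w = 0) :
    ∃ Ψ : F → E, AnalyticAt ℂ Ψ (f z) ∧ ∀ᶠ y in 𝓝 z, Ψ (f y) = y := by
  obtain ⟨l, hl⟩ := (fderiv ℂ f z).toLinearMap.exists_leftInverse_of_injective
    (LinearMap.ker_eq_bot'.2 hinj)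
  let l' : F →L[ℂ] E := LinearMap.toContinuousLinearMap l
  have ha : AnalyticAt ℂ (fun y => l' (f y)) z := (l'.analyticAt _).fun_comp hf
  obtain ⟨Ψ, hΨ, hl, -⟩ := exists_analytic_local_inverse ha (ContinuousLinearEquiv.refl ℂ E) (by
    have hd : HasFDerivAt (fun y => l' (f y)) (l'.comp (fderiv ℂ f z)) z :=
      l'.hasFDerivAt.comp z hf.differentiableAt.hasFDerivAt
    rw [hd.fderiv]
    ext1 w
    exact congrArg (fun g => g w) hl)
  exact ⟨fun p => Ψ (l' p), AnalyticAt.fun_comp (g := Ψ) hΨ (l'.analyticAt _), hl⟩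

end LocalInverse

/-! ### Submersions whose fibres are the leaves -/

section Leaves

variable {m k n r : ℕ} {U : Set (CSp m)} {H Hb K Kb : CSp m → Submodule ℂ (CSp m)}
  {π : CSp m → CSp k}

/-- For W tangent to the fibres, the term of dπ[W, Y] that differentiates dπ(W) = 0 disappears.
Brackets with vertical fields thereby become derivatives of π_*Y along the leaves. -/
theorem fderiv_lieBracket_of_ker {z : CSp m} (hπ : AnalyticAt ℂ π z) {W Y : CSp m → CSp m}
    (hW : AnalyticAt ℂ W z) (hY : AnalyticAt ℂ Y z) (hker : ∀ᶠ y in 𝓝 z, fderiv ℂ π y (W y) = 0) :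
    fderiv ℂ π z (lieBracket ℂ W Y z) = fderiv ℂ (fun y => fderiv ℂ π y (Y y)) z (W z) := by
  rw [fderiv_apply_lieBracket (n := ω) hπ.contDiffAt (by simp)
    hY.differentiableAt hW.differentiableAt]
  have h0 : (fun y => fderiv ℂ π y (W y)) =ᶠ[𝓝 z] fun _ => 0 := hker
  rw [h0.fderiv_eq]
  simp

/-- The fibres of `π` are tangent to `K ⊕ Kb`. -/
structure LeafMap {m k : ℕ} (U : Set (CSp m)) (K Kb : CSp m → Submodule ℂ (CSp m))
    (π : CSp m → CSp k) : Prop where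
  analytic : ∀ z ∈ U, AnalyticAt ℂ π z
  ker_eq : ∀ z ∈ U, LinearMap.ker (fderiv ℂ π z).toLinearMap = K z ⊔ Kb z

theorem LeafMap.swap (hπ : LeafMap U K Kb π) : LeafMap U Kb K π :=
  ⟨hπ.analytic, fun z hz => by rw [hπ.ker_eq z hz, sup_comm]⟩

theorem LeafMap.mem_ker (hπ : LeafMap U K Kb π) {z : CSp m} (hz : z ∈ U) {w : CSp m} :
    fderiv ℂ π z w = 0 ↔ w ∈ K z ⊔ Kb z := by
  rw [← hπ.ker_eq z hz]; rfl

/-- Involutivity of K ⊕ Kb comes from its being the kernel of dπ; it is not among the conditions on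
a `LeviPair`. -/
theorem LeafMap.lieBracket_mem (hπ : LeafMap U K Kb π) (hU : IsOpen U) {z : CSp m} (hz : z ∈ U)
    {X Y : CSp m → CSp m} (hX : IsHolSec (fun y => K y ⊔ Kb y) z X)
    (hY : IsHolSec (fun y => K y ⊔ Kb y) z Y) : lieBracket ℂ X Y z ∈ K z ⊔ Kb z := by
  have h : ∀ {W}, IsHolSec (fun y => K y ⊔ Kb y) z W → ∀ᶠ y in 𝓝 z, fderiv ℂ π y (W y) = 0 := by
    intro W hW
    filter_upwards [hW.2, hU.mem_nhds hz] with y hy hyU using (hπ.mem_ker hyU).2 hy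
  rw [← hπ.mem_ker hz, fderiv_lieBracket_of_ker (hπ.analytic z hz) hX.1 hY.1 (h hX)]
  have h0 : (fun y => fderiv ℂ π y (Y y)) =ᶠ[𝓝 z] fun _ => 0 := h hY
  rw [h0.fderiv_eq]
  simp

theorem LeviPair.inf_ker (h : LeviPair n r U H Hb K Kb) {z : CSp m} (hz : z ∈ U) :
    H z ⊓ (K z ⊔ Kb z) = K z := by
  apply le_antisymm
  · rintro v ⟨hv, hv'⟩
    obtain ⟨a, ha, b, hb, rfl⟩ := Submodule.mem_sup.1 hv'
    have hb' : b ∈ H z := by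
      have := (H z).sub_mem hv (h.kernel_le z hz ha)
      rwa [add_sub_cancel_left] at this
    have : b = 0 := Submodule.disjoint_def.1 (h.disjoint z hz) b hb' (h.kernel_bar_le z hz hb)
    rw [this, add_zero]; exact ha
  · exact le_inf (h.kernel_le z hz) le_sup_left

/-- H meets ker dπ exactly in K. The resulting constancy of the rank of π_*H is what the normalized
frames below need. -/
theorem LeviPair.finrank_map (h : LeviPair n r U H Hb K Kb) (hπ : LeafMap U K Kb π) {z : CSp m}
    (hz : z ∈ U) : Module.finrank ℂ ((H z).map (fderiv ℂ π z).toLinearMap) + r = n := by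
  have h1 := LinearMap.finrank_range_add_finrank_ker ((fderiv ℂ π z).toLinearMap.domRestrict (H z))
  rw [LinearMap.range_domRestrict, h.dist.finrank_eq hz] at h1
  have h2 : Module.finrank ℂ (LinearMap.ker ((fderiv ℂ π z).toLinearMap.domRestrict (H z))) = r := by
    have e : ∀ p q : Submodule ℂ (CSp m), Submodule.comap p.subtype q = (p ⊓ q).submoduleOf p := by
      intro p q; ext v; simp [Submodule.submoduleOf]
    rw [LinearMap.ker_domRestrict, e, hπ.ker_eq z hz, h.inf_ker hz,
      (Submodule.submoduleOfEquivOfLe (h.kernel_le z hz)).finrank_eq, h.dist_kernel.finrank_eq hz]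
  omega

end Leaves

/-! ### Normalized parametrizations of a family of subspaces -/

section Immersion

variable {m k n r : ℕ}

/-- This is the graph chart of the Grassmannian around J: a subspace near J is the range of a
section over J of the projection q. The section is obtained by lifting J to D z, moving the lift to
D y by an analytic projection, pushing it forward by P y and renormalizing. -/
theorem exists_normalized_frame {S : Set (CSp m)} {D : CSp m → Submodule ℂ (CSp m)}
    (hD : IsAnalyticDistribution ℂ S n D) {z : CSp m} (hz : z ∈ S)
    {P : CSp m → CSp m →L[ℂ] CSp k} (hP : AnalyticAt ℂ P z) {J : Submodule ℂ (CSp k)}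
    (hJ : (D z).map (P z).toLinearMap = J)
    (hrank : ∀ᶠ y in 𝓝 z, Module.finrank ℂ ((D y).map (P y).toLinearMap) = Module.finrank ℂ J)
    {q : CSp k →L[ℂ] J} (hq : ∀ v : J, q v = v) :
    ∃ G : CSp m → J →L[ℂ] CSp k, AnalyticAt ℂ G z ∧
      ∀ᶠ y in 𝓝 z, (∀ u, q (G y u) = u) ∧
        LinearMap.range (G y).toLinearMap = (D y).map (P y).toLinearMap := by
  obtain ⟨R, hR, hRe⟩ := hD.exists_proj hz
  have hs : ∀ u : J, ∃ v ∈ D z, P z v = u := by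
    intro u
    have h1 := u.2
    have h2 : (u : CSp k) ∈ (D z).map (P z).toLinearMap := hJ.symm ▸ h1
    exact h2
  obtain ⟨s, hs⟩ : ∃ s : J →ₗ[ℂ] CSp m, ∀ u, s u ∈ D z ∧ P z (s u) = u := by
    let f : D z →ₗ[ℂ] J := ((P z).toLinearMap.domRestrict (D z)).codRestrict J fun v => by
      rw [← hJ]; exact Submodule.mem_map_of_mem v.2
    obtain ⟨g, hg⟩ := f.exists_rightInverse_of_surjective (LinearMap.range_eq_top.2 (by
      intro u
      obtain ⟨v, hv, hvu⟩ := hs u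
      exact ⟨⟨v, hv⟩, Subtype.ext hvu⟩))
    exact ⟨(D z).subtype ∘ₗ g, fun u => ⟨(g u).2,
      congrArg Subtype.val (congrArg (fun l => l u) hg)⟩⟩
  let s' : J →L[ℂ] CSp m := LinearMap.toContinuousLinearMap s
  let M : CSp m → J →L[ℂ] CSp k := fun y => (P y).comp ((R y).comp s')
  have hM : AnalyticAt ℂ M z :=
    AnalyticAt.clm_comp' hP (AnalyticAt.clm_comp' hR analyticAt_const)
  have hMz : ∀ u, M z u = u := by
    intro u
    change P z (R z (s u)) = u
    rw [hRe.self_of_nhds.2 _ (hs u).1, (hs u).2]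
  obtain ⟨T, hT, hTe⟩ := exists_analytic_inverse
    (AnalyticAt.clm_comp' (analyticAt_const (v := q)) hM) (by
      ext1 u
      change q (M z u) = u
      rw [hMz, hq])
  refine ⟨fun y => (M y).comp (T y), AnalyticAt.clm_comp' hM hT, ?_⟩
  filter_upwards [hTe, hRe, hrank] with y hTy hRy hry
  have hq' : ∀ u, q (M y (T y u)) = u := hTy.2
  refine ⟨hq', ?_⟩
  -- The range lies in the pushed-forward space by construction and has the dimension of J, since q
  -- is a left inverse; the constant rank gives equality.
  apply Submodule.eq_of_le_of_finrank_eq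
  · rintro _ ⟨u, rfl⟩
    exact Submodule.mem_map_of_mem (hRy.1 _)
  · rw [hry]
    refine LinearMap.finrank_range_of_inj ?_
    exact Function.LeftInverse.injective (g := q) hq'

/-- Turns equality of subspaces into equality of the analytic maps that represent them. -/
theorem normalized_unique {J : Submodule ℂ (CSp k)} {q : CSp k →L[ℂ] J} {G G' : J →L[ℂ] CSp k}
    (hG : ∀ u, q (G u) = u) (hG' : ∀ u, q (G' u) = u)
    (h : LinearMap.range G.toLinearMap = LinearMap.range G'.toLinearMap) : G = G' := by
  ext1 u
  have h1 : G u ∈ LinearMap.range G'.toLinearMap := h ▸ ⟨u, rfl⟩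
  obtain ⟨u', hu'⟩ := h1
  have h2 : G' u' = G u := hu'
  have h3 := hG' u'
  rw [h2, hG u] at h3
  rw [← h2, h3]

theorem exists_continuous_proj (J : Submodule ℂ (CSp k)) :
    ∃ q : CSp k →L[ℂ] J, ∀ v : J, q v = v := by
  obtain ⟨q, hq⟩ := J.subtype.exists_leftInverse_of_injective J.ker_subtype
  exact ⟨LinearMap.toContinuousLinearMap q, fun v => congrArg (fun l => l v) hq⟩

variable {U : Set (CSp m)} {H Hb K Kb : CSp m → Submodule ℂ (CSp m)} {π : CSp m → CSp k}

theorem LeviPair.exists_frame (h : LeviPair n r U H Hb K Kb) (hπ : LeafMap U K Kb π) {z : CSp m}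
    (hz : z ∈ U) {J : Submodule ℂ (CSp k)} (hJ : (H z).map (fderiv ℂ π z).toLinearMap = J)
    {q : CSp k →L[ℂ] J} (hq : ∀ v : J, q v = v) :
    ∃ G : CSp m → J →L[ℂ] CSp k, AnalyticAt ℂ G z ∧
      ∀ᶠ y in 𝓝 z, (∀ u, q (G y u) = u) ∧
        LinearMap.range (G y).toLinearMap = (H y).map (fderiv ℂ π y).toLinearMap := by
  refine exists_normalized_frame h.dist hz (hπ.analytic z hz).fderiv hJ ?_ hq
  filter_upwards [h.isOpen.mem_nhds hz] with y hy
  have h1 := h.finrank_map hπ hy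
  have h2 := h.finrank_map hπ hz
  rw [hJ] at h2
  omega

/-- The differential of the family `π_* H` along the leaves is injective transversally to `K`. -/
theorem LeviPair.mem_kernel_of_fderiv_eq_zero (h : LeviPair n r U H Hb K Kb)
    (hπ : LeafMap U K Kb π) {z : CSp m} (hz : z ∈ U) {J : Submodule ℂ (CSp k)}
    {q : CSp k →L[ℂ] J} {G : CSp m → J →L[ℂ] CSp k} (hG : AnalyticAt ℂ G z)
    (hGe : ∀ᶠ y in 𝓝 z, (∀ u, q (G y u) = u) ∧
        LinearMap.range (G y).toLinearMap = (H y).map (fderiv ℂ π y).toLinearMap)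
    {w : CSp m} (hw : fderiv ℂ π z w = 0) (hGw : fderiv ℂ G z w = 0) : w ∈ K z := by
  obtain ⟨a, ha, b, hb, rfl⟩ := Submodule.mem_sup.1 ((hπ.mem_ker hz).1 hw)
  obtain ⟨A, hA, rfl⟩ := h.dist_kernel.exists_isHolSec hz ha
  obtain ⟨B, hB, rfl⟩ := h.dist_kernel_bar.exists_isHolSec hz hb
  have hU := h.isOpen.mem_nhds hz
  -- For a section Y of H, π_*Y = G(q(π_*Y)). As dG(w) = 0, the derivative of π_*Y along w = A + B
  -- stays in π_*H, so [A + B, Y] lies in H + Kb. Since [A, Y] lies in H, so does [B, Y] in H + Kb,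
  -- and nondegeneracy gives B = 0.
  have hB0 : B z = 0 := by
    refine h.nondegenerate_bar z hz B hB fun Y hY => ?_
    let f : CSp m → CSp k := fun y => fderiv ℂ π y (Y y)
    have hf : AnalyticAt ℂ f z := AnalyticAt.clm_apply' (hπ.analytic z hz).fderiv hY.1
    have hfe : f =ᶠ[𝓝 z] fun y => G y (q (f y)) := by
      filter_upwards [hGe, hY.2] with y hy hYy
      have h1 : f y ∈ LinearMap.range (G y).toLinearMap :=
        hy.2 ▸ Submodule.mem_map_of_mem hYy
      obtain ⟨u, hu⟩ := h1
      have hu' : G y u = f y := hu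
      rw [← hu', hy.1 u]
    have hd := hG.differentiableAt.hasFDerivAt.clm_apply
      (q.hasFDerivAt.comp z hf.differentiableAt.hasFDerivAt)
    have hmem : fderiv ℂ f z (A z + B z) ∈ (H z).map (fderiv ℂ π z).toLinearMap := by
      rw [hfe.fderiv_eq, HasFDerivAt.fderiv (f := fun y => G y (q (f y))) hd, ← hGe.self_of_nhds.2]
      simp only [add_apply, ContinuousLinearMap.comp_apply, ContinuousLinearMap.flip_apply, hGw,
        zero_apply, add_zero]
      exact ⟨_, rfl⟩
    have hW : ∀ᶠ y in 𝓝 z, fderiv ℂ π y ((A + B) y) = 0 := by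
      filter_upwards [hA.2, hB.2, hU] with y h1 h2 hy
      exact (hπ.mem_ker hy).2 (Submodule.add_mem_sup h1 h2)
    have hbr := fderiv_lieBracket_of_ker (hπ.analytic z hz) (hA.1.add hB.1) hY.1 hW
    rw [show (A + B) z = A z + B z from rfl] at hbr
    change _ = fderiv ℂ f z (A z + B z) at hbr
    rw [← hbr] at hmem
    obtain ⟨y, hy, hye⟩ := hmem
    have h1 : lieBracket ℂ (A + B) Y z - y ∈ K z ⊔ Kb z := by
      rw [← hπ.mem_ker hz, map_sub, sub_eq_zero]
      exact hye.symm
    rw [lieBracket_add_left hA.1.differentiableAt hB.1.differentiableAt] at h1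
    have h2 : lieBracket ℂ A Y z ∈ H z := h.involutive z hz A Y
      (hA.mono (by filter_upwards [hU] with y hy using h.kernel_le y hy)) hY
    have h3 : K z ⊔ Kb z ≤ Kb z ⊔ H z := sup_le ((h.kernel_le z hz).trans le_sup_right) le_sup_left
    have h4 : H z ≤ Kb z ⊔ H z := le_sup_right
    have h5 := Submodule.add_mem _ (Submodule.sub_mem _ (h3 h1) (h4 h2)) (h4 hy)
    convert h5 using 1
    abel
  rw [hB0, add_zero]
  exact hA.mem

variable {U' : Set (CSp m)} {H' Hb' K' Kb' : CSp m → Submodule ℂ (CSp m)} {π' : CSp m → CSp k}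

/-- A continuous map that preserves `π`, `π_* H` and `π_* Hb` is holomorphic. -/
theorem LeviPair.analyticAt_of_canonical (h : LeviPair n r U H Hb K Kb) (hπ : LeafMap U K Kb π)
    (h' : LeviPair n r U' H' Hb' K' Kb') (hπ' : LeafMap U' K' Kb' π') {Φ : CSp m → CSp m}
    (hmaps : Set.MapsTo Φ U U') (hcov : ∀ z ∈ U, π' (Φ z) = π z)
    (hJ : ∀ z ∈ U, (H' (Φ z)).map (fderiv ℂ π' (Φ z)).toLinearMap =
      (H z).map (fderiv ℂ π z).toLinearMap)
    (hJb : ∀ z ∈ U, (Hb' (Φ z)).map (fderiv ℂ π' (Φ z)).toLinearMap =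
      (Hb z).map (fderiv ℂ π z).toLinearMap)
    {z : CSp m} (hz : z ∈ U) (hc : ContinuousAt Φ z) : AnalyticAt ℂ Φ z := by
  have hz' := hmaps hz
  obtain ⟨q, hq⟩ := exists_continuous_proj ((H z).map (fderiv ℂ π z).toLinearMap)
  obtain ⟨p, hp⟩ := exists_continuous_proj ((Hb z).map (fderiv ℂ π z).toLinearMap)
  obtain ⟨G, hG, hGe⟩ := h.exists_frame hπ hz rfl hq
  obtain ⟨Gb, hGb, hGbe⟩ := h.swap.exists_frame hπ.swap hz rfl hp
  -- The same projections q and p normalize the frames on both sides, because the pushed-forward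
  -- spaces at z and at Φ z coincide.
  obtain ⟨G', hG', hGe'⟩ := h'.exists_frame hπ' hz' (hJ z hz) hq
  obtain ⟨Gb', hGb', hGbe'⟩ := h'.swap.exists_frame hπ'.swap hz' (hJb z hz) hp
  have hπz := (hπ'.analytic _ hz')
  -- The triple (π', G', Gb') is an immersion at Φ z: a vector killed by its derivative lies in K' ∩
  -- Kb' = 0. Continuity of Φ then lets Φ be recovered near z as Ψ ∘ (π, G, Gb).
  obtain ⟨Ψ, hΨ, hΨe⟩ := exists_analytic_local_left_inverse
    (f := fun y => (π' y, G' y, Gb' y)) (hπz.prod (hG'.prod hGb')) (by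
      intro w hw
      rw [DifferentiableAt.fderiv_prodMk hπz.differentiableAt
          (hG'.differentiableAt.prodMk hGb'.differentiableAt),
        DifferentiableAt.fderiv_prodMk hG'.differentiableAt hGb'.differentiableAt] at hw
      simp only [ContinuousLinearMap.prod_apply, Prod.mk_eq_zero] at hw
      have h1 := h'.mem_kernel_of_fderiv_eq_zero hπ' hz' hG' hGe' hw.1 hw.2.1
      have h2 := h'.swap.mem_kernel_of_fderiv_eq_zero hπ'.swap hz' hGb' hGbe' hw.1 hw.2.2
      exact Submodule.disjoint_def.1 (h'.disjoint _ hz') w (h'.kernel_le _ hz' h1)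
        (h'.kernel_bar_le _ hz' h2))
  have he : ∀ᶠ y in 𝓝 z, (π' (Φ y), G' (Φ y), Gb' (Φ y)) = (π y, G y, Gb y) := by
    filter_upwards [hGe, hGbe, hc.eventually hGe', hc.eventually hGbe', h.isOpen.mem_nhds hz]
      with y h1 h2 h3 h4 hy
    rw [hcov y hy, normalized_unique h3.1 h1.1 (by rw [h3.2, h1.2, hJ y hy]),
      normalized_unique h4.1 h2.1 (by rw [h4.2, h2.2, hJb y hy])]
  have hcomp : AnalyticAt ℂ (fun y => Ψ (π y, G y, Gb y)) z := by
    refine AnalyticAt.fun_comp (g := Ψ) ?_ ((hπ.analytic z hz).prod (hG.prod hGb))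
    rw [← he.self_of_nhds]
    exact hΨ
  refine hcomp.congr ?_
  filter_upwards [he, hc.eventually hΨe] with y h1 h2
  rw [← h1, h2]

end Immersion

/-! ### Transport by biholomorphisms -/

section Biholomorphism

variable {m n r : ℕ}

/-- `Φ` and `Ψ` are mutually inverse biholomorphisms between the open sets `U` and `U'`. -/
structure BiholOn (U U' : Set (CSp m)) (Φ Ψ : CSp m → CSp m) : Prop where
  isOpen : IsOpen U
  isOpen' : IsOpen U'
  analytic : ∀ z ∈ U, AnalyticAt ℂ Φ z
  analytic' : ∀ z ∈ U', AnalyticAt ℂ Ψ z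
  mapsTo : Set.MapsTo Φ U U'
  mapsTo' : Set.MapsTo Ψ U' U
  left_inv : ∀ z ∈ U, Ψ (Φ z) = z
  right_inv : ∀ z ∈ U', Φ (Ψ z) = z

variable {U U' : Set (CSp m)} {Φ Ψ : CSp m → CSp m}

theorem BiholOn.symm (h : BiholOn U U' Φ Ψ) : BiholOn U' U Ψ Φ :=
  ⟨h.isOpen', h.isOpen, h.analytic', h.analytic, h.mapsTo', h.mapsTo, h.right_inv, h.left_inv⟩

theorem BiholOn.fderiv_left (h : BiholOn U U' Φ Ψ) {z : CSp m} (hz : z ∈ U) (v : CSp m) :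
    fderiv ℂ Ψ (Φ z) (fderiv ℂ Φ z v) = v := by
  have hd := (h.analytic' _ (h.mapsTo hz)).differentiableAt.hasFDerivAt.comp z
    (h.analytic z hz).differentiableAt.hasFDerivAt
  have he : Ψ ∘ Φ =ᶠ[𝓝 z] id := by
    filter_upwards [h.isOpen.mem_nhds hz] with y hy using h.left_inv y hy
  have h1 := hd.fderiv
  rw [he.fderiv_eq, fderiv_id] at h1
  exact (congrArg (fun l => l v) h1).symm

theorem BiholOn.fderiv_right (h : BiholOn U U' Φ Ψ) {z : CSp m} (hz : z ∈ U) (v : CSp m) :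
    fderiv ℂ Φ z (fderiv ℂ Ψ (Φ z) v) = v := by
  have := h.symm.fderiv_left (h.mapsTo hz) v
  rwa [h.left_inv z hz] at this

/-- `pullback` is defined through the total inverse of the derivative, which has a default value at
noninvertible maps; here the true inverse is dΨ. -/
theorem BiholOn.pullback_eq (h : BiholOn U U' Φ Ψ) {z : CSp m} (hz : z ∈ U)
    (V : CSp m → CSp m) : pullback ℂ Φ V z = fderiv ℂ Ψ (Φ z) (V (Φ z)) := by
  let e : CSp m ≃L[ℂ] CSp m := ContinuousLinearEquiv.equivOfInverse (fderiv ℂ Φ z)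
    (fderiv ℂ Ψ (Φ z)) (h.fderiv_left hz) (h.fderiv_right hz)
  exact pullback_eq_of_fderiv_eq (M := e) rfl V

/-- The pull-back of a distribution. -/
def comapDist (Φ : CSp m → CSp m) (D : CSp m → Submodule ℂ (CSp m)) (z : CSp m) :
    Submodule ℂ (CSp m) := (D (Φ z)).comap (fderiv ℂ Φ z).toLinearMap

theorem mem_comapDist {D : CSp m → Submodule ℂ (CSp m)} {z v : CSp m} :
    v ∈ comapDist Φ D z ↔ fderiv ℂ Φ z v ∈ D (Φ z) := Iff.rfl

theorem BiholOn.isHolSec_pullback (h : BiholOn U U' Φ Ψ) {z : CSp m} (hz : z ∈ U)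
    {D : CSp m → Submodule ℂ (CSp m)} {V : CSp m → CSp m} (hV : IsHolSec D (Φ z) V) :
    IsHolSec (comapDist Φ D) z (pullback ℂ Φ V) := by
  have hc := (h.analytic z hz).continuousAt
  constructor
  · have h1 : AnalyticAt ℂ (fun y => fderiv ℂ Ψ (Φ y) (V (Φ y))) z :=
      AnalyticAt.clm_apply'
        (AnalyticAt.fun_comp (g := fderiv ℂ Ψ) (h.analytic' _ (h.mapsTo hz)).fderiv
          (h.analytic z hz))
        (hV.1.fun_comp (h.analytic z hz))
    refine h1.congr ?_
    filter_upwards [h.isOpen.mem_nhds hz] with y hy using (h.pullback_eq hy V).symm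
  · filter_upwards [h.isOpen.mem_nhds hz, hc.eventually hV.2] with y hy hVy
    rw [mem_comapDist, h.pullback_eq hy, h.fderiv_right hy]
    exact hVy

theorem BiholOn.exists_pullback (h : BiholOn U U' Φ Ψ) {z : CSp m} (hz : z ∈ U)
    {D : CSp m → Submodule ℂ (CSp m)} {X : CSp m → CSp m} (hX : IsHolSec (comapDist Φ D) z X) :
    ∃ V, IsHolSec D (Φ z) V ∧ X =ᶠ[𝓝 z] pullback ℂ Φ V := by
  have hz' := h.mapsTo hz
  have hΨ := h.analytic' _ hz'
  have hlz := h.left_inv z hz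
  refine ⟨fun w => fderiv ℂ Φ (Ψ w) (X (Ψ w)), ⟨?_, ?_⟩, ?_⟩
  · refine AnalyticAt.clm_apply' (AnalyticAt.fun_comp (g := fderiv ℂ Φ) ?_ hΨ)
      (AnalyticAt.fun_comp (g := X) ?_ hΨ)
    · rw [hlz]; exact (h.analytic z hz).fderiv
    · rw [hlz]; exact hX.1
  · have hc : Filter.Tendsto Ψ (𝓝 (Φ z)) (𝓝 z) := by
      have := hΨ.continuousAt
      rwa [ContinuousAt, hlz] at this
    filter_upwards [h.isOpen'.mem_nhds hz', hc.eventually hX.2] with w hw hXw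
    have := mem_comapDist.1 hXw
    rwa [h.right_inv w hw] at this
  · filter_upwards [h.isOpen.mem_nhds hz] with y hy
    rw [h.pullback_eq hy, h.left_inv y hy, h.fderiv_left hy]

theorem BiholOn.comapDist_sup (h : BiholOn U U' Φ Ψ) {z : CSp m} (hz : z ∈ U)
    (D D' : CSp m → Submodule ℂ (CSp m)) :
    (D (Φ z) ⊔ D' (Φ z)).comap (fderiv ℂ Φ z).toLinearMap =
      comapDist Φ D z ⊔ comapDist Φ D' z := by
  apply le_antisymm
  · intro v hv
    obtain ⟨a, ha, b, hb, hab⟩ := Submodule.mem_sup.1 (Submodule.mem_comap.1 hv)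
    refine Submodule.mem_sup.2 ⟨fderiv ℂ Ψ (Φ z) a, ?_, fderiv ℂ Ψ (Φ z) b, ?_, ?_⟩
    · rw [mem_comapDist, h.fderiv_right hz]; exact ha
    · rw [mem_comapDist, h.fderiv_right hz]; exact hb
    · rw [← map_add, hab]; exact h.fderiv_left hz v
  · exact sup_le (Submodule.comap_mono le_sup_left) (Submodule.comap_mono le_sup_right)

theorem BiholOn.isAnalyticDistribution_comapDist (h : BiholOn U U' Φ Ψ)
    {D : CSp m → Submodule ℂ (CSp m)} (hD : IsAnalyticDistribution ℂ U' n D) :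
    IsAnalyticDistribution ℂ U n (comapDist Φ D) := by
  intro z hz
  obtain ⟨b, hb, hbe⟩ := hD _ (h.mapsTo hz)
  refine ⟨fun i y => fderiv ℂ Ψ (Φ y) (b i (Φ y)), fun i => AnalyticAt.clm_apply'
        (AnalyticAt.fun_comp (g := fderiv ℂ Ψ) (h.analytic' _ (h.mapsTo hz)).fderiv
          (h.analytic z hz))
        ((hb i).fun_comp (h.analytic z hz)), ?_⟩
  filter_upwards [h.isOpen.mem_nhds hz, (h.analytic z hz).continuousAt.eventually hbe]
    with y hy hby
  constructor
  · refine LinearIndependent.of_comp (fderiv ℂ Φ y).toLinearMap ?_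
    have e : (fderiv ℂ Φ y).toLinearMap ∘ (fun i => fderiv ℂ Ψ (Φ y) (b i (Φ y))) =
        fun i => b i (Φ y) := funext fun i => h.fderiv_right hy _
    rw [e]
    exact hby.1
  · ext v
    rw [mem_comapDist, hby.2, Submodule.mem_span_range_iff_exists_fun,
      Submodule.mem_span_range_iff_exists_fun]
    refine exists_congr fun c => ?_
    simp only [← map_smul, ← map_sum]
    constructor
    · intro hc
      rw [hc, h.fderiv_left hy]
    · intro hc
      rw [← hc, h.fderiv_right hy]

theorem BiholOn.lieBracket_mem (h : BiholOn U U' Φ Ψ) {z : CSp m} (hz : z ∈ U)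
    {X Y V W : CSp m → CSp m} (hV : AnalyticAt ℂ V (Φ z)) (hW : AnalyticAt ℂ W (Φ z))
    (hX : X =ᶠ[𝓝 z] pullback ℂ Φ V) (hY : Y =ᶠ[𝓝 z] pullback ℂ Φ W) :
    fderiv ℂ Φ z (lieBracket ℂ X Y z) = lieBracket ℂ V W (Φ z) := by
  rw [hX.lieBracket_vectorField_eq hY, ← pullback_lieBracket (n := ω) (by simp)
    (h.analytic z hz).contDiffAt hV.differentiableAt hW.differentiableAt, h.pullback_eq hz,
    h.fderiv_right hz]

/-- Sections of a pulled-back distribution are locally the pull-backs of sections, and pull-back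
respects brackets, so every bracket condition is transported. -/
theorem BiholOn.leviPair (h : BiholOn U U' Φ Ψ) {H Hb K Kb : CSp m → Submodule ℂ (CSp m)}
    (hp : LeviPair n r U' H Hb K Kb) :
    LeviPair n r U (comapDist Φ H) (comapDist Φ Hb) (comapDist Φ K) (comapDist Φ Kb) := by
  have hinv : ∀ {D : CSp m → Submodule ℂ (CSp m)}, (∀ z ∈ U', ∀ X Y, IsHolSec D z X →
      IsHolSec D z Y → lieBracket ℂ X Y z ∈ D z) → ∀ z ∈ U, ∀ X Y, IsHolSec (comapDist Φ D) z X →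
      IsHolSec (comapDist Φ D) z Y → lieBracket ℂ X Y z ∈ comapDist Φ D z := by
    intro D hD z hz X Y hX hY
    obtain ⟨V, hV, hVe⟩ := h.exists_pullback hz hX
    obtain ⟨W, hW, hWe⟩ := h.exists_pullback hz hY
    rw [mem_comapDist, h.lieBracket_mem hz hV.1 hW.1 hVe hWe]
    exact hD _ (h.mapsTo hz) V W hV hW
  have hnd : ∀ {D D' : CSp m → Submodule ℂ (CSp m)}, (∀ z ∈ U', ∀ V, IsHolSec D z V →
      (∀ Y, IsHolSec D' z Y → lieBracket ℂ V Y z ∈ D z ⊔ D' z) → V z = 0) →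
      ∀ z ∈ U, ∀ V, IsHolSec (comapDist Φ D) z V →
      (∀ Y, IsHolSec (comapDist Φ D') z Y →
        lieBracket ℂ V Y z ∈ comapDist Φ D z ⊔ comapDist Φ D' z) → V z = 0 := by
    intro D D' hD z hz X hX hY
    obtain ⟨V, hV, hVe⟩ := h.exists_pullback hz hX
    rw [hVe.self_of_nhds, h.pullback_eq hz, hD _ (h.mapsTo hz) V hV, map_zero]
    intro W hW
    rw [← h.lieBracket_mem hz hV.1 hW.1 hVe Filter.EventuallyEq.rfl]
    have h1 := hY _ (h.isHolSec_pullback hz hW)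
    rw [← h.comapDist_sup hz] at h1
    exact h1
  exact
    { isOpen := h.isOpen
      dist := h.isAnalyticDistribution_comapDist hp.dist
      dist_bar := h.isAnalyticDistribution_comapDist hp.dist_bar
      dist_kernel := h.isAnalyticDistribution_comapDist hp.dist_kernel
      dist_kernel_bar := h.isAnalyticDistribution_comapDist hp.dist_kernel_bar
      kernel_le := fun z hz => Submodule.comap_mono (hp.kernel_le _ (h.mapsTo hz))
      kernel_bar_le := fun z hz => Submodule.comap_mono (hp.kernel_bar_le _ (h.mapsTo hz))
      disjoint := fun z hz => by
        rw [Submodule.disjoint_def]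
        intro v hv hv'
        have h0 : fderiv ℂ Φ z v = 0 :=
          Submodule.disjoint_def.1 (hp.disjoint _ (h.mapsTo hz)) _ hv hv'
        rw [← h.fderiv_left hz v, h0, map_zero]
      involutive := hinv hp.involutive
      involutive_bar := hinv hp.involutive_bar
      nondegenerate := hnd hp.nondegenerate
      nondegenerate_bar := hnd hp.nondegenerate_bar }

theorem BiholOn.fderiv_comp {k : ℕ} (h : BiholOn U U' Φ Ψ) {K Kb : CSp m → Submodule ℂ (CSp m)}
    {π π' : CSp m → CSp k} (hπ' : LeafMap U' K Kb π') (hcov : ∀ z ∈ U, π' (Φ z) = π z)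
    {z : CSp m} (hz : z ∈ U) :
    fderiv ℂ π z = (fderiv ℂ π' (Φ z)).comp (fderiv ℂ Φ z) := by
  have he : π =ᶠ[𝓝 z] π' ∘ Φ := by
    filter_upwards [h.isOpen.mem_nhds hz] with y hy using (hcov y hy).symm
  rw [he.fderiv_eq]
  exact _root_.fderiv_comp z (hπ'.analytic _ (h.mapsTo hz)).differentiableAt
    (h.analytic z hz).differentiableAt

theorem BiholOn.leafMap {k : ℕ} (h : BiholOn U U' Φ Ψ) {K Kb : CSp m → Submodule ℂ (CSp m)}
    {π π' : CSp m → CSp k} (hπ' : LeafMap U' K Kb π') (hcov : ∀ z ∈ U, π' (Φ z) = π z)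
    (hπ : ∀ z ∈ U, AnalyticAt ℂ π z) : LeafMap U (comapDist Φ K) (comapDist Φ Kb) π := by
  refine ⟨hπ, fun z hz => ?_⟩
  rw [← h.comapDist_sup hz, ← hπ'.ker_eq _ (h.mapsTo hz), h.fderiv_comp hπ' hcov hz]
  rfl

end Biholomorphism

/-! ### Comparison of two pairs over the same leaf space -/

section Comparison

variable {m n r k : ℕ} {U : Set (CSp m)} {H Hb K Kb H' Hb' K' Kb' : CSp m → Submodule ℂ (CSp m)}
  {π : CSp m → CSp k}

theorem LeviPair.disjoint_kernel_bar (h : LeviPair n r U H Hb K Kb) {z : CSp m} (hz : z ∈ U) :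
    Disjoint (H z) (Kb z) := (h.disjoint z hz).mono_right (h.kernel_bar_le z hz)

/-- A section A of K is vertical, so A = A' + B' with A' in K' and B' in Kb'. For Y in H' ⊂ H ⊕ Kb,
the inclusions [A, H] ⊂ H and [A, Kb] ⊂ K ⊕ Kb put [A, Y] in H ⊕ Kb = H' ⊕ Kb'. Since [A', Y] is in
H', so is [B', Y] in H' ⊕ Kb', and nondegeneracy of the second pair gives B' = 0. -/
theorem LeviPair.kernel_le_of_sup_eq (h : LeviPair n r U H Hb K Kb)
    (h' : LeviPair n r U H' Hb' K' Kb') (hπ : LeafMap U K Kb π) (hπ' : LeafMap U K' Kb' π)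
    (hsup : ∀ z ∈ U, H' z ⊔ Kb' z = H z ⊔ Kb z) {z : CSp m} (hz : z ∈ U) : K z ≤ K' z := by
  have hU := h.isOpen.mem_nhds hz
  intro a ha
  obtain ⟨A, hA, rfl⟩ := h.dist_kernel.exists_isHolSec hz ha
  have hAH : IsHolSec H z A := hA.mono (by filter_upwards [hU] with y hy using h.kernel_le y hy)
  have hker : ∀ y ∈ U, K y ⊔ Kb y = K' y ⊔ Kb' y := fun y hy => by
    rw [← hπ.ker_eq y hy, hπ'.ker_eq y hy]
  obtain ⟨A', B', hA', hB', hAB⟩ := exists_split_isHolSec h'.dist_kernel h'.dist_kernel_bar hz hz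
    ((h'.disjoint_kernel_bar hz).mono_left (h'.kernel_le z hz)) hA
    (by filter_upwards [hU] with y hy using le_sup_left.trans (hker y hy).le)
  have hB0 : B' z = 0 := by
    refine h'.nondegenerate_bar z hz B' hB' fun Y hY => ?_
    obtain ⟨Y₁, C, hY₁, hC, hYC⟩ := exists_split_isHolSec h.dist h.dist_kernel_bar hz hz
      (h.disjoint_kernel_bar hz) hY
      (by filter_upwards [hU] with y hy using le_sup_left.trans (hsup y hy).le)
    have h1 : lieBracket ℂ A Y z ∈ Kb' z ⊔ H' z := by
      rw [sup_comm, hsup z hz, Filter.EventuallyEq.rfl.lieBracket_vectorField_eq hYC,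
        lieBracket_add_right hY₁.1.differentiableAt hC.1.differentiableAt]
      refine Submodule.add_mem _ (Submodule.mem_sup_left (h.involutive z hz A Y₁ hAH hY₁)) ?_
      have h2 := hπ.lieBracket_mem h.isOpen hz
        (hA.mono (.of_forall fun y => le_sup_left)) (hC.mono (.of_forall fun y => le_sup_right))
      exact sup_le_sup_right (h.kernel_le z hz) _ h2
    rw [hAB.lieBracket_vectorField_eq Filter.EventuallyEq.rfl,
      lieBracket_add_left hA'.1.differentiableAt hB'.1.differentiableAt] at h1
    have h3 : lieBracket ℂ A' Y z ∈ Kb' z ⊔ H' z := Submodule.mem_sup_right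
      (h'.involutive z hz A' Y
        (hA'.mono (by filter_upwards [hU] with y hy using h'.kernel_le y hy)) hY)
    exact (Submodule.add_mem_iff_right _ h3).1 h1
  rw [hAB.self_of_nhds, Pi.add_apply, hB0, add_zero]
  exact hA'.mem

/-- This says that y lies in the kernel of ad_v. Write v = w + w' with w in H and w' in H', and
extend w' and y to sections W and Y' of H'. Their bracket is in H' ⊂ H ⊕ Kb. Splitting W and Y'
along H ⊕ Kb, every term but the bracket of the Kb-part of W with the H-part of Y' is visibly in H ⊕
Kb, so that one is too. -/
theorem LeviPair.lieBracket_mem_of_mem_inf (h : LeviPair n r U H Hb K Kb)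
    (h' : LeviPair n r U H' Hb' K' Kb') (hle : ∀ z ∈ U, H' z ≤ H z ⊔ Kb z) {z : CSp m}
    (hz : z ∈ U) {y v : CSp m} (hy : y ∈ H z ⊓ H' z) (hv : v ∈ Kb z ⊓ (H z ⊔ H' z)) :
    ∃ Y, IsHolSec H z Y ∧ Y z = y ∧
      ∀ V, IsHolSec Kb z V → V z = v → lieBracket ℂ V Y z ∈ H z ⊔ Kb z := by
  have hU := h.isOpen.mem_nhds hz
  have hd := h.disjoint_kernel_bar hz
  have hle' : ∀ᶠ y in 𝓝 z, H' y ≤ H y ⊔ Kb y := by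
    filter_upwards [hU] with y hy using hle y hy
  have huniq : ∀ a ∈ H z, ∀ b ∈ Kb z, ∀ a' ∈ H z, ∀ b' ∈ Kb z, a + b = a' + b' →
      a = a' ∧ b = b' := by
    intro a ha b hb a' ha' b' hb' e
    have e1 : a - a' = b' - b := by
      rw [sub_eq_sub_iff_add_eq_add, e, add_comm]
    have e2 : a - a' = 0 := Submodule.disjoint_def.1 hd _ ((H z).sub_mem ha ha')
      (e1 ▸ (Kb z).sub_mem hb' hb)
    rw [e2] at e1
    exact ⟨sub_eq_zero.1 e2, (sub_eq_zero.1 e1.symm).symm⟩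
  obtain ⟨w, hw, w', hw', hww⟩ := Submodule.mem_sup.1 hv.2
  obtain ⟨W, hW, rfl⟩ := h'.dist.exists_isHolSec hz hw'
  obtain ⟨Y', hY', rfl⟩ := h'.dist.exists_isHolSec hz hy.2
  obtain ⟨W₁, V₁, hW₁, hV₁, hWe⟩ :=
    exists_split_isHolSec h.dist h.dist_kernel_bar hz hz hd hW hle'
  obtain ⟨Y₁, C, hY₁, hC, hYe⟩ :=
    exists_split_isHolSec h.dist h.dist_kernel_bar hz hz hd hY' hle'
  have hY₁z := huniq _ hY₁.mem _ hC.mem _ hy.1 0 (Kb z).zero_mem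
    (by rw [add_zero, hYe.self_of_nhds, Pi.add_apply])
  -- The value w' equals -w + v, so by uniqueness of the splitting W₁ and V₁ pass through -w and v.
  have hV₁z := huniq _ hW₁.mem _ hV₁.mem (-w) ((H z).neg_mem hw) v hv.1
    (by rw [← hww, neg_add_cancel_left, hWe.self_of_nhds, Pi.add_apply])
  refine ⟨Y₁, hY₁, hY₁z.1, fun V hV hVz => ?_⟩
  have hbr := hle z hz (h'.involutive z hz W Y' hW hY')
  rw [hWe.lieBracket_vectorField_eq hYe,
    lieBracket_add_left hW₁.1.differentiableAt hV₁.1.differentiableAt,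
    lieBracket_add_right hY₁.1.differentiableAt hC.1.differentiableAt,
    lieBracket_add_right hY₁.1.differentiableAt hC.1.differentiableAt] at hbr
  have hC' : ∀ X, lieBracket ℂ X C z ∈ H z ⊔ Kb z := fun X => Submodule.mem_sup_right
    (lieBracket_mem_of_eq_zero_right h.dist_kernel_bar hz hC hY₁z.2 X)
  have h1 : lieBracket ℂ V₁ Y₁ z ∈ H z ⊔ Kb z := by
    have h2 := (Submodule.add_mem_iff_right _ (Submodule.add_mem _
      (Submodule.mem_sup_left (h.involutive z hz W₁ Y₁ hW₁ hY₁)) (hC' W₁))).1 hbr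
    exact (Submodule.add_mem_iff_left _ (hC' V₁)).1 h2
  have h3 : lieBracket ℂ (V - V₁) Y₁ z ∈ H z ⊔ Kb z := Submodule.mem_sup_right
    (lieBracket_mem_of_eq_zero h.dist_kernel_bar hz (hV.sub hV₁)
      (by rw [Pi.sub_apply, hVz, hV₁z.2, sub_self]) Y₁)
  have h4 : V = (V - V₁) + V₁ := (sub_add_cancel V V₁).symm
  rw [h4, lieBracket_add_left (hV.1.sub hV₁.1).differentiableAt hV₁.1.differentiableAt]
  exact Submodule.add_mem _ h3 h1

/-- By the modular law H ⊕ (Kb ∩ (H + H')) = H + H', whose dimension is 2n - dim(H ∩ H'). -/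
theorem LeviPair.finrank_inf_add (h : LeviPair n r U H Hb K Kb)
    (h' : LeviPair n r U H' Hb' K' Kb') (hle : ∀ z ∈ U, H' z ≤ H z ⊔ Kb z) {z : CSp m}
    (hz : z ∈ U) : Module.finrank ℂ ↥(H z ⊓ H' z) +
      Module.finrank ℂ ↥(Kb z ⊓ (H z ⊔ H' z)) = n := by
  have h1 := Submodule.finrank_sup_add_finrank_inf_eq (H z) (H' z)
  have h2 := Submodule.finrank_sup_add_finrank_inf_eq (H z) (Kb z ⊓ (H z ⊔ H' z))
  have h3 : H z ⊔ Kb z ⊓ (H z ⊔ H' z) = H z ⊔ H' z := by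
    rw [← sup_inf_assoc_of_le _ le_sup_left, inf_eq_right]
    exact sup_le le_sup_left (hle z hz)
  have h4 : H z ⊓ (Kb z ⊓ (H z ⊔ H' z)) = ⊥ :=
    ((h.disjoint_kernel_bar hz).mono_right inf_le_left).eq_bot
  rw [h3, h4, finrank_bot] at h2
  rw [h.dist.finrank_eq hz] at h1 h2
  rw [h'.dist.finrank_eq hz] at h1
  omega

theorem le_of_inf_sup_eq_bot {A A' B : Submodule ℂ (CSp m)} (hle : A' ≤ A ⊔ B)
    (h0 : B ⊓ (A ⊔ A') = ⊥) : A' ≤ A := by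
  intro w hw
  obtain ⟨a, ha, b, hb, rfl⟩ := Submodule.mem_sup.1 (hle hw)
  have hb' : b ∈ B ⊓ (A ⊔ A') := by
    refine ⟨hb, ?_⟩
    have := Submodule.sub_mem _ (Submodule.mem_sup_right hw : a + b ∈ A ⊔ A')
      (Submodule.mem_sup_left ha)
    rwa [add_sub_cancel_left] at this
  rw [h0, Submodule.mem_bot] at hb'
  rw [hb', add_zero]
  exact ha

end Comparison

/-! ### Propagation of equality from real points -/

section Identity

variable {m n r : ℕ}

/-- The inclusion of the real points, as a continuous linear map. -/
def inclL (m : ℕ) : RSp m →L[ℝ] CSp m := LinearMap.toContinuousLinearMap (incl m)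

@[simp] theorem inclL_apply (x : RSp m) : inclL m x = incl m x := rfl

theorem incl_apply (x : RSp m) (i : Fin m) : incl m x i = (x i : ℂ) := rfl

@[simp] theorem star_incl (x : RSp m) : star (incl m x) = incl m x := by
  ext i; simp [incl_apply]

theorem continuous_incl : Continuous (incl m) := (inclL m).continuous

theorem norm_incl (x : RSp m) : ‖incl m x‖ = ‖x‖ := by
  simp [Pi.norm_def, incl_apply]

theorem incl_re_add_im (w : CSp m) :
    incl m (fun i => (w i).re) + Complex.I • incl m (fun i => (w i).im) = w := by
  ext i
  simp only [Pi.add_apply, Pi.smul_apply, incl_apply, smul_eq_mul]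
  rw [mul_comm, Complex.re_add_im]

variable {F : Type*} [NormedAddCommGroup F] [NormedSpace ℂ F] [CompleteSpace F]

/-- Write z = a + ib with a, b real. The function t ↦ f(a + tb) vanishes for small real t, hence by
the one-variable identity theorem also at t = i. -/
theorem eventually_eq_zero_of_real {f : CSp m → F} {p : RSp m} (hf : AnalyticAt ℂ f (incl m p))
    (h0 : ∀ᶠ x in 𝓝 p, f (incl m x) = 0) : ∀ᶠ z in 𝓝 (incl m p), f z = 0 := by
  obtain ⟨ε, hε, hball⟩ := Metric.eventually_nhds_iff_ball.1 hf.eventually_analyticAt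
  obtain ⟨δ, hδ, hreal⟩ := Metric.eventually_nhds_iff_ball.1 h0
  -- With a - p and b shorter than a third of the radius, a + tb stays in the ball for |t| < 2, a
  -- disc that contains t = i.
  have hη : 0 < min ε δ / 3 := by positivity
  filter_upwards [Metric.ball_mem_nhds (incl m p) hη] with z hz
  set a : RSp m := fun i => (z i).re with ha
  set b : RSp m := fun i => (z i).im with hb
  have hzi : ∀ i, ‖z i - p i‖ < min ε δ / 3 := fun i => by
    have := (norm_le_pi_norm (z - incl m p) i).trans_lt (mem_ball_iff_norm.1 hz)
    exact this
  have hap : ‖a - p‖ < min ε δ / 3 := by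
    rw [pi_norm_lt_iff hη]
    intro i
    refine lt_of_le_of_lt ?_ (hzi i)
    have := Complex.abs_re_le_norm (z i - p i)
    simpa [ha] using this
  have hbn : ‖b‖ < min ε δ / 3 := by
    rw [pi_norm_lt_iff hη]
    intro i
    refine lt_of_le_of_lt ?_ (hzi i)
    have := Complex.abs_im_le_norm (z i - p i)
    simpa [hb] using this
  let c : ℂ → CSp m := fun t => incl m a + t • incl m b
  have hcb : ∀ t ∈ Metric.ball (0 : ℂ) 2, c t ∈ Metric.ball (incl m p) (min ε δ) := by
    intro t ht
    rw [mem_ball_zero_iff] at ht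
    rw [mem_ball_iff_norm]
    have e : c t - incl m p = incl m (a - p) + t • incl m b := by
      simp only [c, map_sub]; abel
    calc ‖c t - incl m p‖ ≤ ‖a - p‖ + ‖t‖ * ‖b‖ := by
          rw [e]
          refine (norm_add_le _ _).trans ?_
          rw [norm_smul, norm_incl, norm_incl]
      _ ≤ ‖a - p‖ + 2 * ‖b‖ := by gcongr
      _ < min ε δ := by linarith
  have hg : AnalyticOnNhd ℂ (fun t => f (c t)) (Metric.ball (0 : ℂ) 2) := by
    intro t ht
    refine AnalyticAt.fun_comp (g := f) (hball _ (Metric.ball_subset_ball (min_le_left _ _)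
      (hcb t ht))) ?_
    exact analyticAt_const.add (analyticAt_id.smul analyticAt_const)
  have hfr : ∃ᶠ t in 𝓝[≠] (0 : ℂ), f (c t) = 0 := by
    have h1 : ∃ᶠ t : ℝ in 𝓝[≠] (0 : ℝ), f (c (t : ℂ)) = 0 := by
      refine Filter.Eventually.frequently ?_
      refine nhdsWithin_le_nhds ?_
      filter_upwards [Metric.ball_mem_nhds (0 : ℝ) (by norm_num : (0 : ℝ) < 2)] with t ht
      have e : c (t : ℂ) = incl m (a + t • b) := by
        ext i; simp [c, incl_apply]
      have h2 := hcb (t : ℂ) (by simpa using ht)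
      rw [e, mem_ball_iff_norm, ← map_sub, norm_incl] at h2
      rw [e]
      exact hreal _ (mem_ball_iff_norm.2 (h2.trans_le (min_le_right _ _)))
    refine Filter.Tendsto.frequently (f := fun t : ℝ => (t : ℂ)) ?_ h1
    refine tendsto_nhdsWithin_iff.2 ⟨?_, ?_⟩
    · have : Filter.Tendsto (fun t : ℝ => (t : ℂ)) (𝓝 0) (𝓝 ((0 : ℝ) : ℂ)) :=
        Complex.continuous_ofReal.tendsto 0
      exact (this.mono_left nhdsWithin_le_nhds).trans (by simp)
    · filter_upwards [self_mem_nhdsWithin] with t ht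
      simpa using ht
  have h3 := hg.eqOn_zero_of_preconnected_of_frequently_eq_zero
    (convex_ball (0 : ℂ) 2).isPreconnected (Metric.mem_ball_self (by norm_num)) hfr
  have h4 : f (c Complex.I) = 0 := h3 (by simp)
  have h5 : c Complex.I = z := incl_re_add_im z
  rwa [h5] at h4

variable {U : Set (CSp m)} {H Hb K Kb H' Hb' K' Kb' : CSp m → Submodule ℂ (CSp m)}

/-- Locally, the condition `H' ≤ H` is expressed by the vanishing of analytic functions. -/
theorem LeviPair.exists_equations (h : LeviPair n r U H Hb K Kb)
    (h' : LeviPair n r U H' Hb' K' Kb') (hle : ∀ z ∈ U, H' z ≤ H z ⊔ Kb z) {z : CSp m}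
    (hz : z ∈ U) : ∃ v : Fin n → CSp m → CSp m, (∀ j, AnalyticAt ℂ (v j) z) ∧
      ∀ᶠ y in 𝓝 z, (H' y ≤ H y ↔ ∀ j, v j y = 0) := by
  obtain ⟨P, Q, -, hQ, hPQ⟩ :=
    exists_splitting h.dist h.dist_kernel_bar hz hz (h.disjoint_kernel_bar hz)
  obtain ⟨b, hb, hbe⟩ := h'.dist z hz
  refine ⟨fun j y => Q y (b j y), fun j => AnalyticAt.clm_apply' hQ (hb j), ?_⟩
  filter_upwards [hPQ, hbe, h.isOpen.mem_nhds hz] with y hy hby hyU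
  constructor
  · intro hH j
    exact (hy.2.2.1 _ (hH (hby.2 ▸ Submodule.subset_span ⟨j, rfl⟩))).2
  · intro hv
    rw [hby.2, Submodule.span_le]
    rintro _ ⟨j, rfl⟩
    have h1 := hle y hyU (hby.2 ▸ Submodule.subset_span ⟨j, rfl⟩ : b j y ∈ H' y)
    obtain ⟨c, hc, d, hd, hcd⟩ := Submodule.mem_sup.1 h1
    have h2 := hv j
    simp only [← hcd, map_add, (hy.2.2.1 c hc).2, (hy.2.2.2 d hd).2, zero_add] at h2
    change b j y ∈ H y
    rw [← hcd, h2, add_zero]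
    exact hc

/-- The set of points near which the inclusion holds is open; the local equations and the identity
theorem on a ball make it relatively closed in U. -/
theorem LeviPair.le_of_eventually_le (h : LeviPair n r U H Hb K Kb)
    (h' : LeviPair n r U H' Hb' K' Kb') (hle : ∀ z ∈ U, H' z ≤ H z ⊔ Kb z)
    (hU : IsPreconnected U) {p : CSp m} (hp : p ∈ U) (h0 : ∀ᶠ y in 𝓝 p, H' y ≤ H y) :
    ∀ z ∈ U, H' z ≤ H z := by
  have hsub : U ⊆ {z | ∀ᶠ y in 𝓝 z, H' y ≤ H y} := by
    refine hU.subset_of_closure_inter_subset isOpen_setOfPred_eventually_nhds ⟨p, hp, h0⟩ ?_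
    rintro z ⟨hzc, hz⟩
    obtain ⟨v, hv, hve⟩ := h.exists_equations h' hle hz
    obtain ⟨ε, hε, hball⟩ := Metric.eventually_nhds_iff_ball.1
      (hve.and (Filter.eventually_all.2 fun j => (hv j).eventually_analyticAt))
    obtain ⟨t, htb, ht⟩ := mem_closure_iff.1 hzc _ Metric.isOpen_ball (Metric.mem_ball_self hε)
    have h1 : ∀ j, Set.EqOn (v j) 0 (Metric.ball z ε) := by
      intro j
      have ha : AnalyticOnNhd ℂ (v j) (Metric.ball z ε) := fun y hy => (hball y hy).2 j
      refine ha.eqOn_zero_of_preconnected_of_eventuallyEq_zero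
        (convex_ball z ε).isPreconnected htb ?_
      filter_upwards [Metric.isOpen_ball.mem_nhds htb, ht] with y hy hyt
      exact (hball y hy).1.1 hyt j
    filter_upwards [Metric.ball_mem_nhds z hε] with y hy
    exact (hball y hy).1.2 fun j => h1 j hy
  intro z hz
  exact (hsub hz).self_of_nhds

theorem LeviPair.le_of_real_dense (h : LeviPair n r U H Hb K Kb)
    (h' : LeviPair n r U H' Hb' K' Kb') (hle : ∀ z ∈ U, H' z ≤ H z ⊔ Kb z)
    (hU : IsPreconnected U) {p : RSp m} (hp : incl m p ∈ U) {S : Set (RSp m)}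
    (hS : ∀ᶠ x in 𝓝 p, x ∈ closure S)
    (h0 : ∀ x ∈ S, incl m x ∈ U → H' (incl m x) ≤ H (incl m x)) :
    ∀ z ∈ U, H' z ≤ H z := by
  refine h.le_of_eventually_le h' hle hU hp ?_
  obtain ⟨v, hv, hve⟩ := h.exists_equations h' hle hp
  have ht : Filter.Tendsto (incl m) (𝓝 p) (𝓝 (incl m p)) := continuous_incl.tendsto p
  have hv0 : ∀ j, ∀ᶠ z in 𝓝 (incl m p), v j z = 0 := by
    intro j
    refine eventually_eq_zero_of_real (hv j) ?_
    -- The equations vanish at the points of S near p, and by continuity at every real point near p,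
    -- where S is dense.
    have h1 : ∀ᶠ x in 𝓝 p, ∀ᶠ y in 𝓝 x, (y ∈ S → v j (incl m y) = 0) := by
      refine eventually_eventually_nhds.2 ?_
      filter_upwards [ht.eventually hve, ht.eventually (h.isOpen.mem_nhds hp)] with x hx hxU hxS
      exact hx.1 (h0 x hxS hxU) j
    filter_upwards [hS, h1, ht.eventually (hv j).eventually_analyticAt] with x hx hx1 hx2
    by_contra hne
    have hc : ContinuousAt (fun y => v j (incl m y)) x :=
      ContinuousAt.comp (g := v j) hx2.continuousAt continuous_incl.continuousAt
    obtain ⟨y, hyS, hy1, hy2⟩ := ((mem_closure_iff_frequently.1 hx).and_eventually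
      (hx1.and (hc.eventually_ne hne))).exists
    exact hy2 (hy1 hyS)
  filter_upwards [hve, Filter.eventually_all.2 hv0] with y hy hy0
  exact hy.2 hy0

end Identity

/-! ### Restriction to the real points -/

section Restriction

variable {m n r : ℕ}

theorem hasFDerivAt_comp_incl {X : CSp m → CSp m} {x : RSp m}
    (hX : DifferentiableAt ℂ X (incl m x)) :
    HasFDerivAt (fun y => X (incl m y))
      (((fderiv ℂ X (incl m x)).restrictScalars ℝ).comp (inclL m)) x :=
  HasFDerivAt.comp (g := X) x (hX.hasFDerivAt.restrictScalars ℝ) (inclL m).hasFDerivAt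

/-- Complex linearity of the derivative reassembles the real and imaginary parts of w. This makes
the brackets of restricted holomorphic fields agree with the holomorphic brackets at real points. -/
theorem cderiv_comp_incl {X : CSp m → CSp m} {x : RSp m}
    (hX : DifferentiableAt ℂ X (incl m x)) (w : CSp m) :
    cderiv (fun y => X (incl m y)) x w = fderiv ℂ X (incl m x) w := by
  rw [cderiv, (hasFDerivAt_comp_incl hX).fderiv]
  change fderiv ℂ X (incl m x) (incl m _) + Complex.I • fderiv ℂ X (incl m x) (incl m _) = _
  rw [← map_smul, ← map_add, incl_re_add_im]

theorem cbracket_comp_incl {X Y : CSp m → CSp m} {x : RSp m}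
    (hX : DifferentiableAt ℂ X (incl m x)) (hY : DifferentiableAt ℂ Y (incl m x)) :
    cbracket (fun y => X (incl m y)) (fun y => Y (incl m y)) x =
      lieBracket ℂ X Y (incl m x) := by
  rw [cbracket, cderiv_comp_incl hX, cderiv_comp_incl hY, lieBracket_eq]

theorem cbracket_add_right {X Y Z : RSp m → CSp m} {x : RSp m} (hY : DifferentiableAt ℝ Y x)
    (hZ : DifferentiableAt ℝ Z x) :
    cbracket X (Y + Z) x = cbracket X Y x + cbracket X Z x := by
  rw [cbracket_swap, cbracket_add_left hY hZ, neg_add, ← cbracket_swap, ← cbracket_swap]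

theorem cderiv_vec_zero (X : RSp m → CSp m) (x : RSp m) : cderiv X x 0 = 0 := by
  simpa using cderiv_vec_smul X x 0 0

theorem tendsto_incl (x : RSp m) : Filter.Tendsto (incl m) (𝓝 x) (𝓝 (incl m x)) :=
  continuous_incl.tendsto x

theorem IsHolSec.isSec {D : CSp m → Submodule ℂ (CSp m)} {D₀ : RSp m → Submodule ℂ (CSp m)}
    {x : RSp m} {X : CSp m → CSp m} (hX : IsHolSec D (incl m x) X)
    (hD : ∀ᶠ y in 𝓝 x, D (incl m y) = D₀ y) : IsSec D₀ x fun y => X (incl m y) := by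
  constructor
  · exact ContDiffAt.comp (g := X) x ((hX.1.contDiffAt (n := ∞)).restrict_scalars ℝ)
      (inclL m).contDiff.contDiffAt
  · filter_upwards [hD, (tendsto_incl x).eventually hX.2] with y h1 h2 using h1 ▸ h2

variable {S : Set (CSp m)} {D : CSp m → Submodule ℂ (CSp m)} {D₀ : RSp m → Submodule ℂ (CSp m)}
  {x : RSp m}

/-- Smooth counterpart of `IsAnalyticDistribution.fderiv_mem`; the holomorphic projection onto D
restricts to a smooth one along the real points. -/
theorem IsAnalyticDistribution.cderiv_mem (h : IsAnalyticDistribution ℂ S n D)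
    (hx : incl m x ∈ S) (hD : ∀ᶠ y in 𝓝 x, D (incl m y) = D₀ y) {X : RSp m → CSp m}
    (hX : IsSec D₀ x X) (h0 : X x = 0) (w : CSp m) : cderiv X x w ∈ D₀ x := by
  obtain ⟨P, hP, hPe⟩ := h.exists_proj hx
  let T : RSp m → CSp m →L[ℝ] CSp m := fun y =>
    ContinuousLinearMap.restrictScalarsL ℂ (CSp m) (CSp m) ℝ ℝ (P (incl m y))
  have hT : DifferentiableAt ℝ T x := by
    have h1 : DifferentiableAt ℝ (fun y => P (incl m y)) x :=
      DifferentiableAt.comp (g := P) x (hP.differentiableAt.restrictScalars ℝ)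
        (inclL m).differentiableAt
    exact (ContinuousLinearMap.differentiableAt _).comp x h1
  have he : X =ᶠ[𝓝 x] fun y => T y (X y) := by
    filter_upwards [(tendsto_incl x).eventually hPe, hD, hX.2] with y h1 h2 h3
    exact (h1.2 _ (h2 ▸ h3)).symm
  have hd := hT.hasFDerivAt.clm_apply hX.differentiableAt.hasFDerivAt
  have hf : ∀ u, fderiv ℝ X x u ∈ D₀ x := by
    intro u
    rw [he.fderiv_eq, hd.fderiv]
    simp only [h0, ContinuousLinearMap.comp_apply, map_zero, add_zero]
    rw [← hD.self_of_nhds]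
    exact hPe.self_of_nhds.1 _
  exact (D₀ x).add_mem (hf _) ((D₀ x).smul_mem _ (hf _))

theorem cbracket_mem_of_eq_zero (h : IsAnalyticDistribution ℂ S n D)
    (hx : incl m x ∈ S) (hD : ∀ᶠ y in 𝓝 x, D (incl m y) = D₀ y) {X : RSp m → CSp m}
    (hX : IsSec D₀ x X) (h0 : X x = 0) (Y : RSp m → CSp m) : cbracket X Y x ∈ D₀ x := by
  rw [cbracket, h0, cderiv_vec_zero, zero_sub]
  exact (D₀ x).neg_mem (h.cderiv_mem hx hD hX h0 _)

/-- A smooth section is the restriction of a holomorphic one up to a section that vanishes at the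
given point. -/
theorem IsSec.exists_holSec (h : IsAnalyticDistribution ℂ S n D)
    (hx : incl m x ∈ S) (hD : ∀ᶠ y in 𝓝 x, D (incl m y) = D₀ y) {X : RSp m → CSp m}
    (hX : IsSec D₀ x X) : ∃ X' E, IsHolSec D (incl m x) X' ∧ X' (incl m x) = X x ∧
      IsSec D₀ x E ∧ E x = 0 ∧ X = E + fun y => X' (incl m y) := by
  have h1 : X x ∈ D (incl m x) := hD.self_of_nhds ▸ hX.2.self_of_nhds
  obtain ⟨X', hX', hX'x⟩ := h.exists_isHolSec hx h1
  refine ⟨X', X + (-1 : ℂ) • (fun y => X' (incl m y)), hX', hX'x,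
    hX.add ((hX'.isSec hD).smul _), ?_, ?_⟩
  · simp [hX'x]
  · funext y; simp

end Restriction

/-! ### Levi kernels and the rank hypothesis at real points. -/

section RealPoints

theorem finrank_map_mkQ {V : Type*} [AddCommGroup V] [Module ℂ V] [FiniteDimensional ℂ V]
    {κ N : Submodule ℂ V} (h : κ ≤ N) :
    Module.finrank ℂ (N.map κ.mkQ) + Module.finrank ℂ κ = Module.finrank ℂ N := by
  have h3 := LinearMap.finrank_range_add_finrank_ker (κ.mkQ.domRestrict N)
  rw [LinearMap.range_domRestrict, LinearMap.ker_domRestrict, Submodule.ker_mkQ] at h3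
  rw [← h3, ← (Submodule.submoduleOfEquivOfLe h).finrank_eq]
  rfl

variable {n r : ℕ} {W : Set (RSp (2 * n + 1))} {H : RSp (2 * n + 1) → Submodule ℂ (CSp (2 * n + 1))}
  {U : Set (CSp (2 * n + 1))} {Hc : CSp (2 * n + 1) → Submodule ℂ (CSp (2 * n + 1))}

theorem IsComplexification.eventually_mem (hc : IsComplexification n r W H U Hc)
    {x : RSp (2 * n + 1)} (hx : incl _ x ∈ U) : ∀ᶠ y in 𝓝 x, incl _ y ∈ U :=
  (tendsto_incl x).eventually (hc.isOpen.mem_nhds hx)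

theorem conjHol_incl (D : CSp (2 * n + 1) → Submodule ℂ (CSp (2 * n + 1))) (x : RSp (2 * n + 1)) :
    conjHol D (incl _ x) = conjSub (D (incl _ x)) := by
  rw [conjHol, star_incl]

/-- `leviKernel` tests against all smooth sections, `holKernel` only against holomorphic ones. The
two kinds differ by a section vanishing at x, which does not affect the bracket modulo the conjugate
distribution. This gives one inclusion; both kernels have rank r. -/
theorem IsComplexification.holKernel_eq (hc : IsComplexification n r W H U Hc)
    (hCR : IsCRStructure n r W H) {x : RSp (2 * n + 1)} (hx : incl _ x ∈ U) :
    holKernel Hc (incl _ x) = leviKernel H x := by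
  have hev := hc.eventually_mem hx
  have hHe : ∀ᶠ y in 𝓝 x, Hc (incl _ y) = H y := hev.mono fun y hy => hc.extends_real y hy
  have hHbe : ∀ᶠ y in 𝓝 x, conjHol Hc (incl _ y) = conjDist H y := hHe.mono fun y hy => by
    rw [conjHol_incl, hy, conjDist]
  have hp := hc.leviPair
  refine Submodule.eq_of_le_of_finrank_eq ?_ ?_
  · rintro _ ⟨X, hX, rfl, hXb⟩
    refine ⟨_, hX.isSec hHe, rfl, fun Y hY => ?_⟩
    obtain ⟨Y', E, hY', -, hE, hE0, rfl⟩ := hY.exists_holSec hp.dist_bar hx hHbe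
    rw [cbracket_add_right hE.differentiableAt
      (hY'.isSec hHbe).differentiableAt,
      cbracket_comp_incl hX.1.differentiableAt hY'.1.differentiableAt]
    refine Submodule.add_mem _ (Submodule.mem_sup_right ?_) ?_
    · rw [cbracket_swap]
      exact Submodule.neg_mem _ (cbracket_mem_of_eq_zero hp.dist_bar hx hHbe hE hE0 _)
    · rw [← hHe.self_of_nhds, ← hHbe.self_of_nhds]
      exact hXb Y' hY'
  · rw [hc.dist_kernel.finrank_eq hx, hCR.rank_kernel x (hc.real_mem x hx)]

/-- At a real point without large kernels, a second distribution with the same kernel has trivial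
deviation from `Hc`. -/
theorem IsComplexification.deviation_eq_bot (hc : IsComplexification n r W H U Hc)
    (hCR : IsCRStructure n r W H) {H' Hb' K' Kb' : CSp (2 * n + 1) → Submodule ℂ (CSp (2 * n + 1))}
    (h' : LeviPair n r U H' Hb' K' Kb')
    (hle : ∀ z ∈ U, H' z ≤ Hc z ⊔ conjHol (holKernel Hc) z)
    (hK : ∀ z ∈ U, holKernel Hc z ≤ H' z) {x : RSp (2 * n + 1)} (hx : incl _ x ∈ U)
    (hN : NoLargeKernel n r H x) :
    conjHol (holKernel Hc) (incl _ x) ⊓ (Hc (incl _ x) ⊔ H' (incl _ x)) = ⊥ := by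
  have hev := hc.eventually_mem hx
  have hHe : ∀ᶠ y in 𝓝 x, Hc (incl _ y) = H y := hev.mono fun y hy => hc.extends_real y hy
  have hKbe : ∀ᶠ y in 𝓝 x, conjHol (holKernel Hc) (incl _ y) = conjDist (leviKernel H) y :=
    hev.mono fun y hy => by rw [conjHol_incl, hc.holKernel_eq hCR hy, conjDist]
  have hp := hc.leviPair
  by_contra hne
  -- A nonzero deviation L is itself a forbidden subspace: the common kernel contains N/K, of
  -- dimension n - dim L - r.
  refine hN ⟨_, hne, inf_le_left.trans hKbe.self_of_nhds.le, ?_⟩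
  set L := conjHol (holKernel Hc) (incl _ x) ⊓ (Hc (incl _ x) ⊔ H' (incl _ x)) with hL
  set N := Hc (incl _ x) ⊓ H' (incl _ x) with hNdef
  have hdim : Module.finrank ℂ N + Module.finrank ℂ L = n := hp.finrank_inf_add h' hle hx
  have hNH : N ≤ H x := inf_le_left.trans hHe.self_of_nhds.le
  have hKN : leviKernel H x ≤ N := by
    rw [← hc.holKernel_eq hCR hx]
    exact le_inf (holKernel_le _ _) (hK _ hx)
  have had : ∀ v ∈ L, N ≤ adKernel H x v := by
    intro v hv y hy
    obtain ⟨Y, hY, hYy, hYb⟩ := hp.lieBracket_mem_of_mem_inf h' hle hx hy hv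
    refine ⟨_, hY.isSec hHe, hYy, fun V hV hVv => ?_⟩
    obtain ⟨V', E, hV', hV'x, hE, hE0, rfl⟩ := hV.exists_holSec hp.dist_kernel_bar hx hKbe
    rw [cbracket_add_left hE.differentiableAt (hV'.isSec hKbe).differentiableAt,
      cbracket_comp_incl hV'.1.differentiableAt hY.1.differentiableAt]
    refine Submodule.add_mem _ (Submodule.mem_sup_right
      (cbracket_mem_of_eq_zero hp.dist_kernel_bar hx hKbe hE hE0 _)) ?_
    rw [← hHe.self_of_nhds, ← hKbe.self_of_nhds]
    exact hYb V' hV' (hV'x.trans hVv)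
  set N' := N.submoduleOf (H x) with hN'
  set κ := (leviKernel H x).submoduleOf (H x) with hκ
  have hmap : N'.map κ.mkQ ≤ adKernelInter H x L :=
    le_iInf₂ fun v hv => Submodule.map_mono (Submodule.comap_mono (had v hv))
  have hκN : κ ≤ N' := Submodule.comap_mono hKN
  have h1 : Module.finrank ℂ N' = Module.finrank ℂ N :=
    (Submodule.submoduleOfEquivOfLe hNH).finrank_eq
  have h2 : Module.finrank ℂ κ = r := by
    rw [(Submodule.submoduleOfEquivOfLe (hKN.trans hNH)).finrank_eq,
      hCR.rank_kernel x (hc.real_mem x hx)]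
  have h3 : Module.finrank ℂ (N'.map κ.mkQ) + Module.finrank ℂ κ = Module.finrank ℂ N' :=
    finrank_map_mkQ hκN
  have h4 : (n : ℤ) - r - Module.finrank ℂ L ≤ Module.finrank ℂ (N'.map κ.mkQ) := by omega
  exact h4.trans (Int.ofNat_le.2 (Submodule.finrank_mono hmap))

end RealPoints

/-! ### Functions constant along the leaves -/

section Fibres

variable {m k k' : ℕ} {U : Set (CSp m)} {K Kb : CSp m → Submodule ℂ (CSp m)} {π : CSp m → CSp k}

/-- Together with a projection onto the kernel N of dπ at z, π is a local coordinate system. In it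
the fibre of π is a ball in N, on which the derivative of σ vanishes. -/
theorem LeafMap.eventually_const (hπ : LeafMap U K Kb π) (hU : IsOpen U) {z : CSp m} (hz : z ∈ U)
    (hsurj : LinearMap.range (fderiv ℂ π z).toLinearMap = ⊤) {σ : CSp m → CSp k'}
    (hσ : ∀ y ∈ U, AnalyticAt ℂ σ y)
    (hker : ∀ y ∈ U, ∀ w, fderiv ℂ π y w = 0 → fderiv ℂ σ y w = 0) :
    ∀ᶠ y in 𝓝 z, π y = π z → σ y = σ z := by
  obtain ⟨N, hN⟩ : ∃ N, N = LinearMap.ker (fderiv ℂ π z).toLinearMap := ⟨_, rfl⟩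
  obtain ⟨l, hl⟩ := exists_continuous_proj N
  have hπz := hπ.analytic z hz
  let F : CSp m → CSp k × N := fun y => (π y, l y)
  have hF : AnalyticAt ℂ F z := hπz.prod (l.analyticAt z)
  have hFd : fderiv ℂ F z = (fderiv ℂ π z).prod l := by
    rw [DifferentiableAt.fderiv_prodMk hπz.differentiableAt l.differentiableAt, l.fderiv]
  let e : CSp m ≃L[ℂ] CSp k × N := ContinuousLinearEquiv.ofBijective ((fderiv ℂ π z).prod l) (by
      rw [LinearMap.ker_eq_bot']
      intro w hw
      have h1 : fderiv ℂ π z w = 0 ∧ l w = 0 := Prod.mk_eq_zero.1 hw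
      have h2 : l w = ⟨w, hN.symm ▸ h1.1⟩ := hl ⟨w, hN.symm ▸ h1.1⟩
      exact (congrArg Subtype.val (h1.2.symm.trans h2)).symm) (by
      rw [LinearMap.range_eq_top]
      rintro ⟨γ, u⟩
      obtain ⟨w, hw⟩ := LinearMap.range_eq_top.1 hsurj γ
      have hw' : fderiv ℂ π z w = γ := hw
      have h1 : ∀ v : N, fderiv ℂ π z v = 0 := fun v => by
        have h2 : (v : CSp m) ∈ LinearMap.ker (fderiv ℂ π z).toLinearMap := hN.le v.2
        exact h2
      -- A preimage w of γ under dπ, corrected inside N so that its l-component becomes u.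
      refine ⟨w - l w + u, ?_⟩
      change (fderiv ℂ π z (w - l w + u), l (w - l w + u)) = (γ, u)
      simp only [map_add, map_sub, h1, hl, hw', sub_zero, add_zero, sub_self, zero_add])
  obtain ⟨Ψ, hΨ, hΨl, hΨr⟩ := exists_analytic_local_inverse hF e hFd
  have hz' : Ψ (F z) = z := hΨl.self_of_nhds
  have hΨU : ∀ᶠ p in 𝓝 (F z), Ψ p ∈ U :=
    hΨ.continuousAt.eventually (hz'.symm ▸ hU.mem_nhds hz)
  obtain ⟨ε, hε, hball⟩ := Metric.eventually_nhds_iff_ball.1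
    ((hΨ.eventually_analyticAt.and hΨU).and hΨr)
  have hmem : ∀ u ∈ Metric.ball (l z) ε, ((π z, u) : CSp k × N) ∈ Metric.ball (F z) ε := by
    intro u hu
    rw [Metric.mem_ball, Prod.dist_eq]
    simpa [F, hε] using hu
  have hpair : ∀ u : N, HasFDerivAt (fun u : N => ((π z, u) : CSp k × N))
      (ContinuousLinearMap.inr ℂ (CSp k) N) u := fun u =>
    (hasFDerivAt_const (π z) u).prodMk (hasFDerivAt_id u)
  have hcomp : ∀ u ∈ Metric.ball (l z) ε, HasFDerivAt (fun u : N => Ψ (π z, u))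
      ((fderiv ℂ Ψ (π z, u)).comp (ContinuousLinearMap.inr ℂ (CSp k) N)) u := fun u hu =>
    HasFDerivAt.comp (g := Ψ) u (hball _ (hmem u hu)).1.1.differentiableAt.hasFDerivAt (hpair u)
  have hg : ∀ u ∈ Metric.ball (l z) ε, HasFDerivAt (fun u : N => σ (Ψ (π z, u)))
      (0 : N →L[ℂ] CSp k') u := by
    intro u hu
    have hy := (hball _ (hmem u hu)).1.2
    have h1 : HasFDerivAt (fun u : N => σ (Ψ (π z, u))) _ u :=
      HasFDerivAt.comp (g := σ) u (hσ _ hy).differentiableAt.hasFDerivAt (hcomp u hu)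
    have h2 : HasFDerivAt (fun u : N => π (Ψ (π z, u))) _ u :=
      HasFDerivAt.comp (g := π) u (hπ.analytic _ hy).differentiableAt.hasFDerivAt (hcomp u hu)
    have h3 : (fun u : N => π (Ψ (π z, u))) =ᶠ[𝓝 u] fun _ => π z := by
      filter_upwards [Metric.isOpen_ball.mem_nhds hu] with u' hu'
      exact congrArg Prod.fst (hball _ (hmem u' hu')).2
    -- π is constant on the slice, so the slice directions are vertical and dσ kills them.
    have h4 := h2.unique ((hasFDerivAt_const (π z) u).congr_of_eventuallyEq h3)
    refine h1.congr_fderiv ?_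
    ext1 v
    exact hker _ hy _ (congrArg (fun L => L v) h4)
  have hconst : ∀ u ∈ Metric.ball (l z) ε, σ (Ψ (π z, u)) = σ (Ψ (π z, l z)) := fun u hu =>
    Metric.isOpen_ball.is_const_of_fderiv_eq_zero (𝕜 := ℂ) (f := fun u : N => σ (Ψ (π z, u)))
      (convex_ball (l z) ε).isPreconnected
      (fun u hu => (hg u hu).differentiableAt.differentiableWithinAt)
      (fun u hu => (hg u hu).fderiv) hu (Metric.mem_ball_self hε)
  filter_upwards [hΨl, l.continuous.continuousAt.eventually (Metric.ball_mem_nhds (l z) hε)]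
    with y hy hly hyz
  have h1 := hconst (l y) hly
  have h2 : Ψ (π z, l y) = y := by rw [← hyz]; exact hy
  rw [h2] at h1
  rw [h1]
  exact congrArg σ hz'

/-- Local constancy becomes constancy because the fibres are connected. -/
theorem LeafMap.const_of_ker_le (hπ : LeafMap U K Kb π) (hU : IsOpen U)
    (hsurj : ∀ z ∈ U, LinearMap.range (fderiv ℂ π z).toLinearMap = ⊤)
    (hconn : ∀ γ, IsPreconnected (U ∩ π ⁻¹' {γ})) {σ : CSp m → CSp k'}
    (hσ : ∀ y ∈ U, AnalyticAt ℂ σ y)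
    (hker : ∀ y ∈ U, ∀ w, fderiv ℂ π y w = 0 → fderiv ℂ σ y w = 0)
    {z₁ z₂ : CSp m} (h₁ : z₁ ∈ U) (h₂ : z₂ ∈ U) (h : π z₁ = π z₂) : σ z₁ = σ z₂ := by
  have : PreconnectedSpace ↥(U ∩ π ⁻¹' {π z₂}) := isPreconnected_iff_preconnectedSpace.1 (hconn _)
  have hlc : IsLocallyConstant fun z : ↥(U ∩ π ⁻¹' {π z₂}) => σ z := by
    rw [IsLocallyConstant.iff_eventually_eq]
    rintro ⟨z, hz, hzγ⟩
    have h1 := hπ.eventually_const hU hz (hsurj z hz) hσ hker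
    filter_upwards [continuous_subtype_val.continuousAt.eventually h1] with y hy
    exact hy (y.2.2.trans hzγ.symm)
  exact hlc.apply_eq_of_preconnectedSpace ⟨z₁, h₁, h⟩ ⟨z₂, h₂, rfl⟩

end Fibres

/-! ### The canonical map -/

section Canonical

variable {m k n r : ℕ} {U U' : Set (CSp m)} {Hc Hc' : CSp m → Submodule ℂ (CSp m)}
  {π π' : CSp m → CSp k}

theorem IsLeviLeafSpace.leafMap (hπ : IsLeviLeafSpace U Hc π) (hU : IsOpen U) :
    LeafMap U (holKernel Hc) (conjHol (holKernel Hc)) π :=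
  ⟨fun _ hz => analyticAt_of_differentiableOn hU hπ.holomorphic hz, hπ.ker_eq⟩

theorem IsLeviLeafSpace.canF_injective (hπ : IsLeviLeafSpace U Hc π) {z w : CSp m} (hz : z ∈ U)
    (hw : w ∈ U) (h : canF π Hc z = canF π Hc w) : z = w :=
  congrArg Subtype.val (hπ.embedding.injective (a₁ := ⟨z, hz⟩) (a₂ := ⟨w, hw⟩) h)

/-- The families J⁻ and J⁺ agree only separately, which gives two points of one fibre; the product
structure of U' merges them into one. -/
theorem exists_canF_eq (hπ' : IsLeviLeafSpace U' Hc' π')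
    (hassoc : associated U' Hc' π' = associated U Hc π) {z : CSp m} (hz : z ∈ U) :
    ∃ z' ∈ U', canF π' Hc' z' = canF π Hc z := by
  have h1 : pushAt π Hc z ∈ (associated U' Hc' π').Jminus (π z) := by
    rw [hassoc]; exact ⟨z, hz, rfl, rfl⟩
  have h2 : pushAt π (conjHol Hc) z ∈ (associated U' Hc' π').Jplus (π z) := by
    rw [hassoc]; exact ⟨z, hz, rfl, rfl⟩
  obtain ⟨z₁, hz₁, e₁, hJ₁⟩ := h1
  obtain ⟨z₂, hz₂, e₂, hJ₂⟩ := h2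
  obtain ⟨z', hz', e', hJ, hJb⟩ := hπ'.product z₁ hz₁ z₂ hz₂ (e₁.trans e₂.symm)
  exact ⟨z', hz', Prod.ext (e'.trans e₁) (Prod.ext (hJ.trans hJ₁.symm) (hJb.trans hJ₂.symm))⟩

/-- Continuity comes from the embedding property: Φ composed with the embedding of U' is the
continuous map `canF π Hc`. -/
theorem exists_canonical_map (hU : IsOpen U) (hπ : IsLeviLeafSpace U Hc π)
    (hπ' : IsLeviLeafSpace U' Hc' π')
    (hassoc : associated U' Hc' π' = associated U Hc π) :
    ∃ Φ : CSp m → CSp m, Set.MapsTo Φ U U' ∧ (∀ z ∈ U, canF π' Hc' (Φ z) = canF π Hc z) ∧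
      ∀ z ∈ U, ContinuousAt Φ z := by
  have h : ∀ z, ∃ z', z ∈ U → z' ∈ U' ∧ canF π' Hc' z' = canF π Hc z := by
    intro z
    by_cases hz : z ∈ U
    · obtain ⟨z', h1, h2⟩ := exists_canF_eq hπ' hassoc hz
      exact ⟨z', fun _ => ⟨h1, h2⟩⟩
    · exact ⟨z, fun h => absurd h hz⟩
  choose Φ hΦ using h
  refine ⟨Φ, fun z hz => (hΦ z hz).1, fun z hz => (hΦ z hz).2, ?_⟩
  have hc : Continuous fun z : U => (⟨Φ z, (hΦ z z.2).1⟩ : U') := by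
    rw [hπ'.embedding.isInducing.continuous_iff]
    have e : (fun z : U' => canF π' Hc' z) ∘ (fun z : U => (⟨Φ z, (hΦ z z.2).1⟩ : U')) =
        fun z : U => canF π Hc z := funext fun z => (hΦ z z.2).2
    rw [e]
    exact hπ.embedding.continuous
  have hco : ContinuousOn Φ U := continuousOn_iff_continuous_domRestrict.2
    (continuous_subtype_val.comp hc)
  exact fun z hz => hco.continuousAt (hU.mem_nhds hz)

/-- Identifies what π_*H remembers of H: the sum H ⊕ Kb, and nothing finer. -/
theorem LeviPair.comap_map {H Hb K Kb : CSp m → Submodule ℂ (CSp m)}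
    (h : LeviPair n r U H Hb K Kb) (hπ : LeafMap U K Kb π) {z : CSp m} (hz : z ∈ U) :
    ((H z).map (fderiv ℂ π z).toLinearMap).comap (fderiv ℂ π z).toLinearMap = H z ⊔ Kb z := by
  rw [Submodule.comap_map_eq, hπ.ker_eq z hz, ← sup_assoc, sup_eq_left.2 (h.kernel_le z hz)]

/-- A biholomorphism over the leaf space that preserves `π_* H` preserves `H ⊕ Kb`. -/
theorem BiholOn.comapDist_sup_eq {Φ Ψ : CSp m → CSp m} (hΦ : BiholOn U U' Φ Ψ)
    {H Hb K Kb H' Hb' K' Kb' : CSp m → Submodule ℂ (CSp m)}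
    (h : LeviPair n r U H Hb K Kb) (hπ : LeafMap U K Kb π)
    (h' : LeviPair n r U' H' Hb' K' Kb') (hπ' : LeafMap U' K' Kb' π')
    (hcov : ∀ z ∈ U, π' (Φ z) = π z) {z : CSp m} (hz : z ∈ U)
    (hJ : (H' (Φ z)).map (fderiv ℂ π' (Φ z)).toLinearMap =
      (H z).map (fderiv ℂ π z).toLinearMap) :
    comapDist Φ H' z ⊔ comapDist Φ Kb' z = H z ⊔ Kb z := by
  rw [← hΦ.comapDist_sup hz, ← h.comap_map hπ hz, ← h'.comap_map hπ' (hΦ.mapsTo hz), hJ,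
    hΦ.fderiv_comp hπ' hcov hz]
  rfl

/-- Moves the pushed-forward space at `star z` to the point z, at the price of replacing π by its
conjugate. -/
theorem map_star_eq {z : CSp m} (hπ : AnalyticAt ℂ π (star z))
    (D : CSp m → Submodule ℂ (CSp m)) :
    (D (star z)).map (fderiv ℂ π (star z)).toLinearMap =
      conjSub ((conjHol D z).map (fderiv ℂ (conjMap π) z).toLinearMap) := by
  ext v
  rw [mem_conjSub]
  constructor
  · rintro ⟨w, hw, rfl⟩
    refine ⟨star w, by simpa [mem_conjHol] using hw, ?_⟩
    change fderiv ℂ (conjMap π) z (star w) = star (fderiv ℂ π (star z) w)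
    rw [fderiv_conjMap hπ.differentiableAt, star_star]
  · rintro ⟨w, hw, hwv⟩
    refine ⟨star w, hw, ?_⟩
    have h1 : fderiv ℂ (conjMap π) z w = star v := hwv
    rw [fderiv_conjMap hπ.differentiableAt] at h1
    exact star_injective h1

end Canonical

/-! ### Recoverability -/

section Recover

variable {n r k : ℕ} {W W' : Set (RSp (2 * n + 1))}
  {H H' : RSp (2 * n + 1) → Submodule ℂ (CSp (2 * n + 1))}
  {U U' : Set (CSp (2 * n + 1))} {Hc Hc' : CSp (2 * n + 1) → Submodule ℂ (CSp (2 * n + 1))}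
  {π π' : CSp (2 * n + 1) → CSp k}

theorem map_comapDist {m j : ℕ} {V V' : Set (CSp m)} {Φ Ψ : CSp m → CSp m}
    (hΦ : BiholOn V V' Φ Ψ) {z : CSp m} (hz : z ∈ V) (D : CSp m → Submodule ℂ (CSp m))
    (T : CSp m →L[ℂ] CSp j) :
    (comapDist Φ D z).map (T.comp (fderiv ℂ Φ z)).toLinearMap =
      (D (Φ z)).map T.toLinearMap := by
  have h1 : (comapDist Φ D z).map (fderiv ℂ Φ z).toLinearMap = D (Φ z) :=
    Submodule.map_comap_eq_of_surjective (fun v => ⟨_, hΦ.fderiv_right hz v⟩) _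
  conv_rhs => rw [← h1, ← Submodule.map_comp]
  rfl

theorem map_sup_eq_of_le_ker {V V' : Type*} [AddCommGroup V] [Module ℂ V] [AddCommGroup V']
    [Module ℂ V'] (f : V →ₗ[ℂ] V') (A : Submodule ℂ V) {B : Submodule ℂ V}
    (hB : B ≤ LinearMap.ker f) : (A ⊔ B).map f = A.map f := by
  have h1 : B.map f = ⊥ := by
    rw [eq_bot_iff]
    rintro _ ⟨b, hb, rfl⟩
    exact hB hb
  rw [Submodule.map_sup, h1, sup_bot_eq]

/-- Conjugation exchanges the two summands of K ⊕ K̄, so the conjugate of π has the same vertical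
directions. -/
theorem IsComplexification.fderiv_conjMap_eq_zero (hc : IsComplexification n r W H U Hc)
    (hπ : IsLeviLeafSpace U Hc π) {z w : CSp (2 * n + 1)} (hz : z ∈ U)
    (hw : w ∈ holKernel Hc z ⊔ conjHol (holKernel Hc) z) : fderiv ℂ (conjMap π) z w = 0 := by
  have hl := hπ.leafMap hc.isOpen
  have hz' := hc.star_mem z hz
  rw [fderiv_conjMap (hl.analytic _ hz').differentiableAt, star_eq_zero, hl.mem_ker hz']
  obtain ⟨a, ha, b, hb, rfl⟩ := Submodule.mem_sup.1 hw
  rw [star_add, add_comm (star a)]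
  exact Submodule.add_mem_sup hb (by simpa [mem_conjHol] using ha)

/-- Shows that the involution, recorded only as a graph, is single valued on the leaf space. -/
theorem IsComplexification.apply_star_eq (hc : IsComplexification n r W H U Hc)
    (hπ : IsLeviLeafSpace U Hc π) {z₁ z₂ : CSp (2 * n + 1)} (h₁ : z₁ ∈ U) (h₂ : z₂ ∈ U)
    (h : π z₁ = π z₂) : π (star z₁) = π (star z₂) := by
  have hl := hπ.leafMap hc.isOpen
  have h3 := hl.const_of_ker_le hc.isOpen hπ.submersion hπ.leaf_connected (σ := conjMap π)
    (fun y hy => analyticAt_conjMap (hl.analytic _ (hc.star_mem y hy)))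
    (fun y hy w hw => hc.fderiv_conjMap_eq_zero hπ hy ((hl.mem_ker hy).1 hw)) h₁ h₂ h
  exact star_injective h3

/-- The canonical map is built in both directions; injectivity of `canF` makes the two maps mutually
inverse. -/
theorem IsComplexification.exists_biholOn (hc : IsComplexification n r W H U Hc)
    (hπ : IsLeviLeafSpace U Hc π) (hc' : IsComplexification n r W' H' U' Hc')
    (hπ' : IsLeviLeafSpace U' Hc' π') (hassoc : associated U' Hc' π' = associated U Hc π) :
    ∃ Φ Ψ, BiholOn U U' Φ Ψ ∧ ∀ z ∈ U, canF π' Hc' (Φ z) = canF π Hc z := by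
  obtain ⟨Φ, hΦm, hΦ, hΦc⟩ := exists_canonical_map hc.isOpen hπ hπ' hassoc
  obtain ⟨Ψ, hΨm, hΨ, hΨc⟩ := exists_canonical_map hc'.isOpen hπ' hπ hassoc.symm
  refine ⟨Φ, Ψ, ⟨hc.isOpen, hc'.isOpen, fun z hz => ?_, fun z hz => ?_, hΦm, hΨm, fun z hz => ?_,
    fun z hz => ?_⟩, hΦ⟩
  · exact hc.leviPair.analyticAt_of_canonical (hπ.leafMap hc.isOpen) hc'.leviPair
      (hπ'.leafMap hc'.isOpen) hΦm (fun z hz => congrArg Prod.fst (hΦ z hz))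
      (fun z hz => congrArg (fun p => p.2.1) (hΦ z hz))
      (fun z hz => congrArg (fun p => p.2.2) (hΦ z hz)) hz (hΦc z hz)
  · exact hc'.leviPair.analyticAt_of_canonical (hπ'.leafMap hc'.isOpen) hc.leviPair
      (hπ.leafMap hc.isOpen) hΨm (fun z hz => congrArg Prod.fst (hΨ z hz))
      (fun z hz => congrArg (fun p => p.2.1) (hΨ z hz))
      (fun z hz => congrArg (fun p => p.2.2) (hΨ z hz)) hz (hΨc z hz)
  · exact hπ.canF_injective (hΨm (hΦm hz)) hz ((hΨ _ (hΦm hz)).trans (hΦ z hz))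
  · exact hπ'.canF_injective (hΦm (hΨm hz)) hz ((hΦ _ (hΨm hz)).trans (hΨ z hz))

/-- Both points have the same image under `canF`. The leaf-space components agree by the common
involution. The subspaces at `star z` are conjugates of images under d(`conjMap π`), which kills K ⊕
K̄; these images depend only on H ⊕ K̄ and H̄ ⊕ K, and Φ preserves both sums. -/
theorem IsComplexification.canonical_star (hc : IsComplexification n r W H U Hc)
    (hπ : IsLeviLeafSpace U Hc π) (hc' : IsComplexification n r W' H' U' Hc')
    (hπ' : IsLeviLeafSpace U' Hc' π') (hassoc : associated U' Hc' π' = associated U Hc π)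
    {Φ Ψ : CSp (2 * n + 1) → CSp (2 * n + 1)} (hΦ : BiholOn U U' Φ Ψ)
    (hcan : ∀ z ∈ U, canF π' Hc' (Φ z) = canF π Hc z) {z : CSp (2 * n + 1)} (hz : z ∈ U) :
    Φ (star z) = star (Φ z) := by
  have hl := hπ.leafMap hc.isOpen
  have hl' := hπ'.leafMap hc'.isOpen
  have hzs := hc.star_mem z hz
  have hΦs := hc'.star_mem _ (hΦ.mapsTo hz)
  have hcov : ∀ z ∈ U, π' (Φ z) = π z := fun z hz => congrArg Prod.fst (hcan z hz)
  have hinv : ∀ z ∈ U, π' (star (Φ z)) = π (star z) := by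
    intro z hz
    -- The common graph only yields some point z₁ in the fibre of z; that the involution is well
    -- defined on fibres replaces z₁ by z.
    have h1 : (π' (Φ z), π' (star (Φ z))) ∈ (associated U' Hc' π').involution :=
      ⟨Φ z, hΦ.mapsTo hz, rfl⟩
    rw [hassoc] at h1
    obtain ⟨z₁, hz₁, he⟩ := h1
    rw [Prod.mk.injEq] at he
    rw [he.2]
    exact hc.apply_star_eq hπ hz₁ hz (he.1.symm.trans (hcov z hz))
  have hder : fderiv ℂ (conjMap π) z =
      (fderiv ℂ (conjMap π') (Φ z)).comp (fderiv ℂ Φ z) := by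
    have he : conjMap π =ᶠ[𝓝 z] conjMap π' ∘ Φ := by
      filter_upwards [hc.isOpen.mem_nhds hz] with y hy
      exact congrArg star (hinv y hy).symm
    rw [he.fderiv_eq]
    exact fderiv_comp z (analyticAt_conjMap (hl'.analytic _ hΦs)).differentiableAt
      (hΦ.analytic z hz).differentiableAt
  have key : ∀ {D Kb₀ D' Kb₀' : CSp (2 * n + 1) → Submodule ℂ (CSp (2 * n + 1))},
      Kb₀ z ≤ holKernel Hc z ⊔ conjHol (holKernel Hc) z →
      Kb₀' (Φ z) ≤ holKernel Hc' (Φ z) ⊔ conjHol (holKernel Hc') (Φ z) →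
      comapDist Φ D' z ⊔ comapDist Φ Kb₀' z = D z ⊔ Kb₀ z →
      (D' (Φ z)).map (fderiv ℂ (conjMap π') (Φ z)).toLinearMap =
        (D z).map (fderiv ℂ (conjMap π) z).toLinearMap := by
    intro D Kb₀ D' Kb₀' h1 h2 h3
    rw [← map_sup_eq_of_le_ker _ (D z)
        (fun w hw => hc.fderiv_conjMap_eq_zero hπ hz (h1 hw) : Kb₀ z ≤ _), ← h3,
      ← hΦ.comapDist_sup hz, hder]
    have h4 := map_comapDist hΦ hz (fun y => D' y ⊔ Kb₀' y) (fderiv ℂ (conjMap π') (Φ z))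
    rw [map_sup_eq_of_le_ker _ (D' (Φ z)) (fun w hw =>
      hc'.fderiv_conjMap_eq_zero hπ' (hΦ.mapsTo hz) (h2 hw) : Kb₀' (Φ z) ≤ _)] at h4
    exact h4.symm
  have hJ := key (D := Hc) (D' := Hc') le_sup_right le_sup_right
    (hΦ.comapDist_sup_eq hc.leviPair hl hc'.leviPair hl' hcov hz
      (congrArg (fun p => p.2.1) (hcan z hz)))
  have hJb := key (D := conjHol Hc) (D' := conjHol Hc') le_sup_left le_sup_left
    (hΦ.comapDist_sup_eq hc.leviPair.swap hl.swap hc'.leviPair.swap hl'.swap hcov hz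
      (congrArg (fun p => p.2.2) (hcan z hz)))
  refine hπ'.canF_injective (hΦ.mapsTo hzs) hΦs ((hcan _ hzs).trans ?_)
  refine Prod.ext (hinv z hz).symm (Prod.ext ?_ ?_)
  · change (Hc (star z)).map (fderiv ℂ π (star z)).toLinearMap =
      (Hc' (star (Φ z))).map (fderiv ℂ π' (star (Φ z))).toLinearMap
    rw [map_star_eq (hl.analytic _ hzs), map_star_eq (hl'.analytic _ hΦs), hJb]
  · change (conjHol Hc (star z)).map (fderiv ℂ π (star z)).toLinearMap =
      (conjHol Hc' (star (Φ z))).map (fderiv ℂ π' (star (Φ z))).toLinearMap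
    rw [map_star_eq (hl.analytic _ hzs), map_star_eq (hl'.analytic _ hΦs), conjHol_conjHol,
      conjHol_conjHol, hJ]

theorem IsCRStructure.recoverableAt (hCR : IsCRStructure n r W H)
    (hdense : W ⊆ closure {x | NoLargeKernel n r H x}) (p : RSp (2 * n + 1)) :
    RecoverableAt n r W H p := by
  intro k U Hc π hp hc hπ W' H' U' Hc' π' _ hc' hπ' hassoc
  obtain ⟨Φ, Ψ, hΦ, hcan⟩ := hc.exists_biholOn hπ hc' hπ' hassoc
  have hl := hπ.leafMap hc.isOpen
  have hl' := hπ'.leafMap hc'.isOpen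
  have hcov : ∀ z ∈ U, π' (Φ z) = π z := fun z hz => congrArg Prod.fst (hcan z hz)
  have hP := hc.leviPair
  have hP' := hΦ.leviPair hc'.leviPair
  have hL' := hΦ.leafMap hl' hcov hl.analytic
  have hsup : ∀ z ∈ U, comapDist Φ Hc' z ⊔ comapDist Φ (conjHol (holKernel Hc')) z =
      Hc z ⊔ conjHol (holKernel Hc) z := fun z hz =>
    hΦ.comapDist_sup_eq hP hl hc'.leviPair hl' hcov hz (congrArg (fun p => p.2.1) (hcan z hz))
  have hle : ∀ z ∈ U, comapDist Φ Hc' z ≤ Hc z ⊔ conjHol (holKernel Hc) z := fun z hz =>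
    le_sup_left.trans (hsup z hz).le
  have hK : ∀ z ∈ U, holKernel Hc z ≤ comapDist Φ Hc' z := fun z hz =>
    (hP.kernel_le_of_sup_eq hP' hl hL' hsup hz).trans (hP'.kernel_le z hz)
  have hHle := hP.le_of_real_dense hP' hle hc.isConnected.isPreconnected hp
    (S := {x | NoLargeKernel n r H x})
    (Filter.mem_of_superset (hCR.isOpen.mem_nhds (hc.real_mem p hp)) hdense)
    fun x hx hxU => le_of_inf_sup_eq_bot (hle _ hxU) (hc.deviation_eq_bot hCR hP' hle hK hxU hx)
  have hHeq : ∀ z ∈ U, comapDist Φ Hc' z = Hc z := fun z hz =>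
    Submodule.eq_of_le_of_finrank_eq (hHle z hz) (by
      rw [hP.dist.finrank_eq hz, hP'.dist.finrank_eq hz])
  have hbij : Set.BijOn Φ U U' := by
    refine ⟨hΦ.mapsTo, fun a ha b hb hab => ?_, fun y hy => ⟨Ψ y, hΦ.mapsTo' hy, hΦ.right_inv y hy⟩⟩
    rw [← hΦ.left_inv a ha, ← hΦ.left_inv b hb, hab]
  refine ⟨Φ, hbij, fun z hz => (hΦ.analytic z hz).differentiableAt.differentiableWithinAt, ?_, hcov,
    fun z hz => hc.canonical_star hπ hc' hπ' hassoc hΦ hcan hz, fun z hz => ?_⟩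
  -- On U' the chosen inverse `invFunOn` coincides with Ψ, since Φ is injective on U.
  · refine DifferentiableOn.congr (f := Ψ) (fun z hz =>
      (hΦ.analytic' z hz).differentiableAt.differentiableWithinAt) fun z hz => ?_
    have h1 : ∃ a ∈ U, Φ a = z := ⟨Ψ z, hΦ.mapsTo' hz, hΦ.right_inv z hz⟩
    have h2 := Function.invFunOn_eq h1
    conv_rhs => rw [← h2]
    exact (hΦ.left_inv _ (Function.invFunOn_mem h1)).symm
  · rw [← hHeq z hz]
    exact Submodule.map_comap_eq_of_surjective (fun v => ⟨_, hΦ.fderiv_right hz v⟩) _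

end Recover

end CRGeom

end

/-! ### Passage from charts to the manifold. -/

theorem mainTheorem12 (n r : ℕ) {M : Type*} [TopologicalSpace M]
    [ChartedSpace (CRGeom.RSp (2 * n + 1)) M]
    [IsManifold 𝓘(ℝ, CRGeom.RSp (2 * n + 1)) ω M]
    (H : ∀ p : M, Submodule ℂ (ℂ ⊗[ℝ] TangentSpace 𝓘(ℝ, CRGeom.RSp (2 * n + 1)) p))
    (hH : CRGeom.IsCRManifold r H)
    (hgen : Dense {p : M | CRGeom.NoLargeKernelAt r H p}) :
    CRGeom.IsRecoverable r H := by
  intro p e he hp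
  refine (hH e he).recoverableAt ?_ _
  intro x hx
  rw [mem_closure_iff]
  intro O hO hxO
  -- A chart carries the dense set of generic points to a dense subset of its target, since
  -- preimages of open sets in the source are open in M.
  obtain ⟨q, hq, hqN⟩ := hgen.inter_open_nonempty (e.source ∩ e ⁻¹' O)
    (e.isOpen_inter_preimage hO)
    ⟨e.symm x, e.map_target hx, by simpa [e.right_inv hx] using hxO⟩
  exact ⟨e q, hq.2, hqN e he hq.1⟩
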